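/- **Theorem 1.1.** Let $-\infty<a<b<\infty$ and $\lambda>0$. Let $K$ satisfy - (K1) $K:[0,\infty)\to[0,\infty)$ is continuous and strictly increasing, with $K(0)=0$; - (K2) for every $M>0$ there is a constant $C_M>0$ such that $K(\rho_1)+K(\rho_2)\ge K(\rho_1+\rho_2)+C_M\rho_1\rho_2$ for all $\rho_1,\rho_2\ge 0$ with $\rho_1+\rho_2\le M$; - (K3) $\lim_{\rho\downarrow 0}K(\rho)/\rho=1$. For $u\in BV(a,b)$ (that is, $u\in L^1(a,b)$ and the distributional derivative $Du$ is a finite signed Radon measure on $(a,b)$), let $J_u\subset(a,b)$ be the set of approximate jump points of $u$, i.e. the points at which $u$ has two different one-sided approximate limits $u^\pm$, and let $$TV_K(u)=|Du|\big((a,b)\setminus J_u\big)+\sum_{x\in J_u}K\big(|u^+(x)-u^-(x)|\big).$$ Let $g\in C[a,b]$, and let $U\in BV(a,b)$ be a minimizer over $BV(a,b)$ of $$TV_{Kg}(u)=TV_K(u)+\frac{\lambda}{2}\int_a^b|u-g|^2\,dx .$$ Then $J_U$ is finite, and $U$ has a representative (equal to $U$ a.e. on $(a,b)$) that is continuous on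 $[a,b]\setminus J_U$, is piecewise constant with finitely many pieces, and takes values in $[\min_{[a,b]}g,\ \max_{[a,b]}g]$ on $[a,b]$. Moreover, let $M>0$ satisfy $M\ge \max_{[a,b]}g-\min_{[a,b]}g$, let $C_M>0$ be any constant for which the inequality in (K2) holds for this $M$, and let $c_M>0$ be any constant with $K(\rho)\ge c_M\rho$ for all $\rho\in[0,M]$. Then the number $m$ of points of $J_U$ satisfies $$m\le\left[\frac{(b-a)\lambda}{A_M}\right]+1,\qquad A_M=\min\left\{\frac{c_M}{M},\,2C_M\right\},$$ where $[r]$ denotes the integer part of $r\ge0$. -/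

import Mathlib

namespace KWC

open MeasureTheory Set Filter Topology
open scoped ContDiff ENNReal

/-- The signed measure `μ`, carried by the open interval `(a, b)`, is the distributional
derivative of `u` on `(a, b)`: `∫ u φ' dx = - ∫ φ dμ` for every test function
`φ ∈ C_c^∞(a, b)`. The integral against `μ` is written with its Jordan decomposition. -/
def IsDistribDeriv (a b : ℝ) (u : ℝ → ℝ) (μ : SignedMeasure ℝ) : Prop :=
  μ.totalVariation (Ioo a b)ᶜ = 0 ∧
    ∀ φ : ℝ → ℝ, ContDiff ℝ ∞ φ → HasCompactSupport φ → tsupport φ ⊆ Ioo a b →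
      ∫ x in Ioo a b, u x * deriv φ x =
        -(∫ x, φ x ∂μ.toJordanDecomposition.posPart -
          ∫ x, φ x ∂μ.toJordanDecomposition.negPart)

/-- `u ∈ BV(a, b)`: `u` is integrable on `(a, b)` and its distributional derivative is a finite
signed Radon measure on `(a, b)`. Only the a.e. class of `u` on `(a, b)` matters. -/
def MemBV (a b : ℝ) (u : ℝ → ℝ) : Prop :=
  IntegrableOn u (Ioo a b) ∧ ∃ μ : SignedMeasure ℝ, IsDistribDeriv a b u μ

open Classical in
/-- The measure `Du` of a function `u ∈ BV(a, b)` (zero if `u` is not of bounded variation). -/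
noncomputable def distribDeriv (a b : ℝ) (u : ℝ → ℝ) : SignedMeasure ℝ :=
  if h : ∃ μ : SignedMeasure ℝ, IsDistribDeriv a b u μ then h.choose else 0

/-- `l` is the approximate limit of `u` at `x` from the right. -/
def IsRightTrace (u : ℝ → ℝ) (x l : ℝ) : Prop :=
  Tendsto (fun r : ℝ => ⨍ y in Ioo x (x + r), |u y - l|) (𝓝[>] 0) (𝓝 0)

/-- `l` is the approximate limit of `u` at `x` from the left. -/
def IsLeftTrace (u : ℝ → ℝ) (x l : ℝ) : Prop :=
  Tendsto (fun r : ℝ => ⨍ y in Ioo (x - r) x, |u y - l|) (𝓝[>] 0) (𝓝 0)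

/-- The (approximate) jump set `J_u` of `u` in `(a, b)`: the points at which `u` has approximate
limits from both sides and these are different. -/
def jumpSet (a b : ℝ) (u : ℝ → ℝ) : Set ℝ :=
  {x | x ∈ Ioo a b ∧ ∃ l r : ℝ, l ≠ r ∧ IsLeftTrace u x l ∧ IsRightTrace u x r}

/-- The one-sided approximate limits, at points where they exist. -/
noncomputable def leftTrace (u : ℝ → ℝ) (x : ℝ) : ℝ := Classical.epsilon (IsLeftTrace u x)

/-- See `leftTrace`. -/
noncomputable def rightTrace (u : ℝ → ℝ) (x : ℝ) : ℝ := Classical.epsilon (IsRightTrace u x)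

/-- `TV_K(u) = |Du|((a, b) \ J_u) + ∑_{x ∈ J_u} K(|u⁺(x) - u⁻(x)|)`, for `u ∈ BV(a, b)`. -/
noncomputable def TVK (K : ℝ → ℝ) (a b : ℝ) (u : ℝ → ℝ) : ℝ≥0∞ :=
  (distribDeriv a b u).totalVariation (Ioo a b \ jumpSet a b u) +
    ∑' x : jumpSet a b u, ENNReal.ofReal (K |rightTrace u x - leftTrace u x|)

/-- `TV_{Kg}(u) = TV_K(u) + (λ/2) ∫_a^b |u - g|² dx`; the parameter `lam` is `λ`. -/
noncomputable def TVKg (K : ℝ → ℝ) (lam : ℝ) (g : ℝ → ℝ) (a b : ℝ) (u : ℝ → ℝ) : ℝ≥0∞ :=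
  TVK K a b u +
    ENNReal.ofReal (lam / 2) * ∫⁻ x in Ioo a b, ENNReal.ofReal (|u x - g x| ^ 2)

/-- `U ∈ BV(a, b)` minimizes `TV_{Kg}` over `BV(a, b)`. -/
def IsMinimizer (K : ℝ → ℝ) (lam : ℝ) (g : ℝ → ℝ) (a b : ℝ) (U : ℝ → ℝ) : Prop :=
  MemBV a b U ∧ ∀ v : ℝ → ℝ, MemBV a b v → TVKg K lam g a b U ≤ TVKg K lam g a b v

/-- `K : [0, ∞) → [0, ∞)` is continuous and strictly increasing with `K 0 = 0` (so that it is
automatically nonnegative). Values at negative arguments play no role. -/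
def CondK1 (K : ℝ → ℝ) : Prop :=
  ContinuousOn K (Ici 0) ∧ StrictMonoOn K (Ici 0) ∧ K 0 = 0

/-- The constant `C` is admissible for `K` on `[0, M]`. -/
def IsMergeConst (K : ℝ → ℝ) (M C : ℝ) : Prop :=
  0 < C ∧ ∀ ρ₁ ρ₂ : ℝ, 0 ≤ ρ₁ → 0 ≤ ρ₂ → ρ₁ + ρ₂ ≤ M →
    K (ρ₁ + ρ₂) + C * ρ₁ * ρ₂ ≤ K ρ₁ + K ρ₂

/-- For every `M > 0` there is `C_M > 0` with
`K(ρ₁) + K(ρ₂) ≥ K(ρ₁ + ρ₂) + C_M ρ₁ ρ₂` whenever `ρ₁, ρ₂ ≥ 0`, `ρ₁ + ρ₂ ≤ M`. -/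
def CondK2 (K : ℝ → ℝ) : Prop :=
  ∀ M : ℝ, 0 < M → ∃ C : ℝ, IsMergeConst K M C

/-- `K(ρ)/ρ → 1` as `ρ ↓ 0`. -/
def CondK3 (K : ℝ → ℝ) : Prop :=
  Tendsto (fun ρ : ℝ => K ρ / ρ) (𝓝[>] 0) (𝓝 1)

/-- `V` is piecewise constant on `[a, b]` with finitely many pieces: it is constant on each open
interval of some finite partition `a = x₀ < x₁ < ⋯ < xₙ = b`. -/
def IsPiecewiseConst (a b : ℝ) (V : ℝ → ℝ) : Prop :=
  ∃ (n : ℕ) (x : ℕ → ℝ), x 0 = a ∧ x n = b ∧ (∀ i < n, x i < x (i + 1)) ∧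
    ∀ i < n, ∃ c : ℝ, ∀ y ∈ Ioo (x i) (x (i + 1)), V y = c

end KWC

namespace KWC

open MeasureTheory Set Filter Topology
open scoped ContDiff ENNReal

/-! A function in BV on an interval is, up to a null set, a constant plus the distribution function
of its derivative (`IsDistribDeriv.exists_ae_eq_cumul`, by du Bois-Reymond). The problem thus
becomes one about a pair of mutually singular measures `σ`, `κ`. The jumps are the atoms, and `TVK`
is the functional `varK` of `σ + κ` (`TVK_eq_varK`).

The heart is a comparison on a short interval `(s, t)`. Suppose the larger of the two masses is `P =
σ(s, t)` and the smaller is `N = κ(s, t)`, and let `Q` be the sum of the squared atoms of `σ` there.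
Replace the minimizer on the interval by one jump of height `P - N` at a point `p`, and average over
`p` with law `σ / P`. Merging lowers the variation by at least `C/2 (P² - Q) + c N`
(`le_toReal_varK`). On average the fidelity grows by at most `λ(t - s)(M N + (P² - Q)/4)`: the
second term is the variance of a randomly placed jump, the first the bias caused by cancelling `κ`
(`random_jump_pointwise`). If `λ(t - s) < min (c/M) (2C)`, minimality forces `N = 0` and `P² = Q`,
so `σ` has a single atom and no diffuse part on the interval (`single_atom_of_jump_le`).

With a crude bound `M` and compactness this makes `σ + κ` a finite sum of atoms. The minimizer is
then a step function, and truncation to the range of `g` shows that it takes values in that range.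
This allows the sharp `M`: two consecutive jumps closer than `A_M/λ` would lie in an interval to
which the comparison applies, so jumps are separated and can be counted. -/

/-- The function `x ↦ c + (σ - κ)((-∞, x])`, whose distributional derivative is `σ - κ`. -/
noncomputable def cumul (c : ℝ) (σ κ : Measure ℝ) (x : ℝ) : ℝ :=
  c + (σ.real (Iic x) - κ.real (Iic x))

/-! ### Distribution functions and integration by parts. -/

theorem integrable_indicator_snd_le_fst (ρ σ : Measure ℝ) [SFinite ρ] [IsFiniteMeasure σ]
    {f : ℝ → ℝ} (hf : Integrable f ρ) :
    Integrable ({z : ℝ × ℝ | z.2 ≤ z.1}.indicator fun z => f z.1) (ρ.prod σ) :=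
  (hf.comp_fst σ).indicator (measurableSet_le measurable_snd measurable_fst)

theorem integral_indicator_snd_le_fst (ρ : Measure ℝ) (f : ℝ → ℝ) (p : ℝ) :
    ∫ x, {z : ℝ × ℝ | z.2 ≤ z.1}.indicator (fun z => f z.1) (x, p) ∂ρ = ∫ x in Ici p, f x ∂ρ := by
  rw [← integral_indicator measurableSet_Ici]
  congr 1

theorem integrable_setIntegral_Ici (ρ σ : Measure ℝ) [SFinite ρ] [IsFiniteMeasure σ] {f : ℝ → ℝ}
    (hf : Integrable f ρ) : Integrable (fun p => ∫ x in Ici p, f x ∂ρ) σ := by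
  have := (integrable_indicator_snd_le_fst ρ σ hf).integral_prod_right
  simpa only [integral_indicator_snd_le_fst] using this

/-- Fubini on the half plane `p ≤ x`. It serves twice: to differentiate distribution functions, and
to average over the position `p` of a random jump. -/
theorem integral_mul_real_Iic (ρ σ : Measure ℝ) [SFinite ρ] [IsFiniteMeasure σ] {f : ℝ → ℝ}
    (hf : Integrable f ρ) :
    ∫ x, f x * σ.real (Iic x) ∂ρ = ∫ p, ∫ x in Ici p, f x ∂ρ ∂σ := by
  have hswap := integral_integral_swap
    (f := fun x p : ℝ => {z : ℝ × ℝ | z.2 ≤ z.1}.indicator (fun z => f z.1) (x, p))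
    (integrable_indicator_snd_le_fst ρ σ hf)
  have h1 : ∀ x, ∫ p, {z : ℝ × ℝ | z.2 ≤ z.1}.indicator (fun z => f z.1) (x, p) ∂σ
      = f x * σ.real (Iic x) := by
    intro x
    have : (fun p : ℝ => {z : ℝ × ℝ | z.2 ≤ z.1}.indicator (fun z => f z.1) (x, p))
        = (Iic x).indicator (fun _ => f x) := by
      ext p; simp [indicator]
    rw [this, integral_indicator measurableSet_Iic]
    simp [mul_comm]
  simpa only [h1, integral_indicator_snd_le_fst] using hswap

theorem measurable_real_Iic (σ : Measure ℝ) [IsFiniteMeasure σ] :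
    Measurable fun x => σ.real (Iic x) := by
  refine Monotone.measurable fun x y hxy => ?_
  exact measureReal_mono (Iic_subset_Iic.2 hxy)

theorem measurable_cumul (c : ℝ) (σ κ : Measure ℝ) [IsFiniteMeasure σ] [IsFiniteMeasure κ] :
    Measurable (cumul c σ κ) :=
  measurable_const.add ((measurable_real_Iic σ).sub (measurable_real_Iic κ))

theorem abs_cumul_le (c : ℝ) (σ κ : Measure ℝ) [IsFiniteMeasure σ] [IsFiniteMeasure κ] (x : ℝ) :
    |cumul c σ κ x| ≤ |c| + (σ.real univ + κ.real univ) := by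
  have h1 : σ.real (Iic x) ≤ σ.real univ := measureReal_mono (subset_univ _)
  have h2 : κ.real (Iic x) ≤ κ.real univ := measureReal_mono (subset_univ _)
  have h3 : 0 ≤ σ.real (Iic x) := measureReal_nonneg
  have h4 : 0 ≤ κ.real (Iic x) := measureReal_nonneg
  unfold cumul
  refine (abs_add_le _ _).trans (add_le_add le_rfl ?_)
  rw [abs_le]; constructor <;> linarith

theorem integrableOn_cumul (a b c : ℝ) (σ κ : Measure ℝ) [IsFiniteMeasure σ] [IsFiniteMeasure κ] :
    IntegrableOn (cumul c σ κ) (Ioo a b) :=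
  Integrable.of_bound (measurable_cumul c σ κ).aestronglyMeasurable _
    (Eventually.of_forall fun x => abs_cumul_le c σ κ x)

theorem integral_deriv_mul_real_Iic (σ : Measure ℝ) [IsFiniteMeasure σ] {φ : ℝ → ℝ}
    (h1 : ContDiff ℝ ∞ φ) (h2 : HasCompactSupport φ) :
    ∫ x, deriv φ x * σ.real (Iic x) = -∫ x, φ x ∂σ := by
  have h1' : ContDiff ℝ 1 φ := h1.of_le (by simp)
  rw [integral_mul_real_Iic volume σ
    ((h1'.continuous_deriv le_rfl).integrable_of_hasCompactSupport h2.deriv), ← integral_neg]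
  refine integral_congr_ae (Eventually.of_forall fun p => ?_)
  simp only
  rw [integral_Ici_eq_integral_Ioi, h2.integral_Ioi_deriv_eq h1']

theorem setIntegral_cumul_mul_deriv (a b c : ℝ) (σ κ : Measure ℝ) [IsFiniteMeasure σ]
    [IsFiniteMeasure κ] {φ : ℝ → ℝ} (h1 : ContDiff ℝ ∞ φ) (h2 : HasCompactSupport φ)
    (h3 : tsupport φ ⊆ Ioo a b) :
    ∫ x in Ioo a b, cumul c σ κ x * deriv φ x = -(∫ x, φ x ∂σ - ∫ x, φ x ∂κ) := by
  have h1' : ContDiff ℝ 1 φ := h1.of_le (by simp)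
  have hint : Integrable (deriv φ) :=
    (h1'.continuous_deriv le_rfl).integrable_of_hasCompactSupport h2.deriv
  have hb : ∀ (σ : Measure ℝ) [IsFiniteMeasure σ],
      Integrable fun x => deriv φ x * σ.real (Iic x) := fun σ _ =>
    hint.mul_bdd (c := σ.real univ) (measurable_real_Iic σ).aestronglyMeasurable
      (Eventually.of_forall fun x => by
        rw [Real.norm_of_nonneg measureReal_nonneg]
        exact measureReal_mono (subset_univ _))
  rw [setIntegral_eq_integral_of_forall_compl_eq_zero]
  · have : ∀ x, cumul c σ κ x * deriv φ x
        = c * deriv φ x + (deriv φ x * σ.real (Iic x) - deriv φ x * κ.real (Iic x)) := by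
      intro x; unfold cumul; ring
    simp_rw [this]
    have hsub : Integrable fun x => deriv φ x * σ.real (Iic x) - deriv φ x * κ.real (Iic x) :=
      (hb σ).sub (hb κ)
    rw [integral_add (hint.const_mul c) hsub, integral_sub (hb σ) (hb κ),
      integral_const_mul, integral_eq_zero_of_hasDerivAt_of_integrable
        (fun x => (h1'.differentiable one_ne_zero x).hasDerivAt) hint
        (h1.continuous.integrable_of_hasCompactSupport h2),
      integral_deriv_mul_real_Iic σ h1 h2, integral_deriv_mul_real_Iic κ h1 h2]
    ring
  · intro x hx
    have : deriv φ x = 0 := by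
      by_contra hne
      exact hx (h3 (support_deriv_subset hne))
    simp [this]

/-! ### The lemma of du Bois-Reymond. -/

theorem exists_Icc_of_isCompact_subset_Ioo {a b : ℝ} (hab : a < b) {s : Set ℝ} (hs : IsCompact s)
    (hsub : s ⊆ Ioo a b) : ∃ c d, a < c ∧ d < b ∧ s ⊆ Icc c d := by
  rcases s.eq_empty_or_nonempty with rfl | hne
  -- The endpoints are swapped, so that `Icc b a` is empty.
  · exact ⟨b, a, hab, hab, empty_subset _⟩
  · obtain ⟨c, hc⟩ := hs.exists_isLeast hne
    obtain ⟨d, hd⟩ := hs.exists_isGreatest hne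
    exact ⟨c, d, (hsub hc.1).1, (hsub hd.1).2, fun x hx => ⟨hc.2 hx, hd.2 hx⟩⟩

/-- A test function of mean zero is the derivative of a test function. -/
theorem exists_primitive_of_integral_eq_zero {a b : ℝ} (hab : a < b) {θ : ℝ → ℝ}
    (h1 : ContDiff ℝ ∞ θ) (h2 : HasCompactSupport θ) (h3 : tsupport θ ⊆ Ioo a b)
    (h4 : ∫ x, θ x = 0) :
    ∃ φ : ℝ → ℝ, ContDiff ℝ ∞ φ ∧ HasCompactSupport φ ∧ tsupport φ ⊆ Ioo a b ∧
      deriv φ = θ := by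
  obtain ⟨c, d, hac, hdb, hcd⟩ := exists_Icc_of_isCompact_subset_Ioo hab h2.isCompact h3
  have hzero : ∀ x, x ∉ Icc c d → θ x = 0 := fun x hx =>
    image_eq_zero_of_notMem_tsupport fun h => hx (hcd h)
  have hint : Integrable θ := h1.continuous.integrable_of_hasCompactSupport h2
  set φ : ℝ → ℝ := fun x => ∫ t in Iic x, θ t with hφ
  have hφ' : ∀ x, φ x = φ 0 + ∫ t in (0 : ℝ)..x, θ t := by
    intro x
    have := intervalIntegral.integral_Iic_sub_Iic (hint.integrableOn (s := Iic 0))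
      (hint.integrableOn (s := Iic x))
    simp only [hφ]; linarith
  have hder : ∀ x, HasDerivAt φ (θ x) x := by
    intro x
    have : φ = fun x => φ 0 + ∫ t in (0 : ℝ)..x, θ t := funext hφ'
    rw [this]
    exact (intervalIntegral.integral_hasDerivAt_right (h1.continuous.intervalIntegrable _ _)
      (h1.continuous.stronglyMeasurableAtFilter _ _) h1.continuous.continuousAt).const_add _
  have hderiv : deriv φ = θ := funext fun x => (hder x).deriv
  have hsupp : ∀ x, x ∉ Icc c d → φ x = 0 := by
    intro x hx
    by_cases hxc : x < c
    · simp only [hφ]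
      refine setIntegral_eq_zero_of_forall_eq_zero fun t ht => hzero t fun h => ?_
      exact absurd h.1 (not_le.2 (lt_of_le_of_lt ht hxc))
    · have hxd : d < x := by
        by_contra h; exact hx ⟨not_lt.1 hxc, not_lt.1 h⟩
      simp only [hφ]
      rw [setIntegral_eq_integral_of_forall_compl_eq_zero, h4]
      intro t ht
      refine hzero t fun h => ?_
      exact ht (h.2.trans hxd.le)
  have hts : tsupport φ ⊆ Icc c d :=
    closure_minimal (fun x hx => by by_contra h; exact hx (hsupp x h)) isClosed_Icc
  refine ⟨φ, ?_, ?_, hts.trans fun x hx => ⟨hac.trans_le hx.1, hx.2.trans_lt hdb⟩, hderiv⟩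
  · rw [contDiff_infty_iff_deriv, hderiv]
    exact ⟨fun x => (hder x).differentiableAt, h1⟩
  · exact HasCompactSupport.of_support_subset_isCompact isCompact_Icc
      ((subset_tsupport φ).trans hts)

/-- The lemma of du Bois-Reymond. -/
theorem ae_const_of_integral_mul_deriv_eq_zero {a b : ℝ} (hab : a < b) {w : ℝ → ℝ}
    (hw : IntegrableOn w (Ioo a b))
    (h : ∀ φ : ℝ → ℝ, ContDiff ℝ ∞ φ → HasCompactSupport φ → tsupport φ ⊆ Ioo a b →
      ∫ x in Ioo a b, w x * deriv φ x = 0) :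
    ∃ k, ∀ᵐ x ∂volume.restrict (Ioo a b), w x = k := by
  let f : ContDiffBump ((a + b) / 2) := ⟨(b - a) / 8, (b - a) / 4, by linarith, by linarith⟩
  set η : ℝ → ℝ := f.normed volume with hη
  have hη1 : ContDiff ℝ ∞ η := f.contDiff_normed
  have hη2 : HasCompactSupport η := f.hasCompactSupport_normed
  have hη3 : tsupport η ⊆ Ioo a b := by
    rw [hη, f.tsupport_normed_eq, Real.closedBall_eq_Icc]
    intro x hx
    have h1 := hx.1
    have h2 := hx.2
    simp only [f] at h1 h2
    constructor <;> linarith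
  have hη4 : ∫ x, η x = 1 := f.integral_normed
  have hprod : ∀ ψ : ℝ → ℝ, ContDiff ℝ ∞ ψ → HasCompactSupport ψ →
      IntegrableOn (fun x => w x * ψ x) (Ioo a b) := by
    intro ψ h1 h2
    obtain ⟨B, hB⟩ := h2.exists_bound_of_continuous h1.continuous
    exact hw.mul_bdd (c := B) h1.continuous.aestronglyMeasurable (Eventually.of_forall hB)
  set k := ∫ x in Ioo a b, w x * η x with hk
  refine ⟨k, ?_⟩
  have key := isOpen_Ioo.ae_eq_zero_of_integral_contDiff_smul_eq_zero (U := Ioo a b)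
    (f := (Ioo a b).indicator fun x => w x - k) (μ := volume) ?_ ?_
  · rw [ae_restrict_iff' measurableSet_Ioo]
    filter_upwards [key] with x hx hxI
    have := hx hxI
    rw [indicator_of_mem hxI] at this
    linarith
  · apply Integrable.locallyIntegrable _ |>.locallyIntegrableOn
    rw [integrable_indicator_iff measurableSet_Ioo]
    exact Integrable.sub hw (integrableOn_const (by simp))
  · intro ψ h1 h2 h3
    have hψi : Integrable ψ := h1.continuous.integrable_of_hasCompactSupport h2
    have hηi : Integrable η := hη1.continuous.integrable_of_hasCompactSupport hη2
    set q := ∫ x, ψ x with hq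
    have hsub : tsupport (fun x => ψ x - q * η x) ⊆ tsupport ψ ∪ tsupport η := by
      refine closure_minimal (fun x hx => ?_) ((isClosed_tsupport _).union (isClosed_tsupport _))
      by_contra hc
      rw [mem_union, not_or] at hc
      apply hx
      simp [image_eq_zero_of_notMem_tsupport hc.1, image_eq_zero_of_notMem_tsupport hc.2]
    -- Subtracting `q` times the unit bump `η` gives mean zero, so `ψ - q η` is the derivative of an
    -- admissible test function.
    obtain ⟨φ, g1, g2, g3, g4⟩ := exists_primitive_of_integral_eq_zero hab
      (θ := fun x => ψ x - q * η x) (h1.sub (contDiff_const.mul hη1))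
      (HasCompactSupport.of_support_subset_isCompact (h2.isCompact.union hη2.isCompact)
        ((subset_tsupport _).trans hsub))
      (hsub.trans (union_subset h3 hη3))
      (by rw [integral_sub hψi (hηi.const_mul q), integral_const_mul, hη4]; simp [hq])
    have h0 := h φ g1 g2 g3
    rw [g4] at h0
    have e1 : ∫ x in Ioo a b, w x * (ψ x - q * η x)
        = (∫ x in Ioo a b, w x * ψ x) - q * k := by
      rw [hk, ← integral_const_mul, ← integral_sub (hprod ψ h1 h2) ((hprod η hη1 hη2).const_mul q)]
      congr 1; ext x; ring
    have e2 : ∫ x in Ioo a b, ψ x = q :=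
      setIntegral_eq_integral_of_forall_compl_eq_zero fun x hx =>
        image_eq_zero_of_notMem_tsupport fun h => hx (h3 h)
    have e3 : (fun x => ψ x • (Ioo a b).indicator (fun x => w x - k) x)
        = (Ioo a b).indicator fun x => w x * ψ x - k * ψ x := by
      ext x
      by_cases hx : x ∈ Ioo a b
      · simp only [indicator_of_mem hx, smul_eq_mul]; ring
      · simp [indicator_of_notMem hx]
    rw [e3, integral_indicator measurableSet_Ioo,
      integral_sub (hprod ψ h1 h2) ((hψi.const_mul k).integrableOn), integral_const_mul, e2]
    linarith

/-! ### One-sided limits of distribution functions and uniqueness of the derivative. -/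

theorem tendsto_real_Iic_right (σ : Measure ℝ) [IsFiniteMeasure σ] (x : ℝ) :
    Tendsto (fun y => σ.real (Iic y)) (𝓝[>] x) (𝓝 (σ.real (Iic x))) := by
  refine (ENNReal.tendsto_toReal (measure_ne_top σ _)).comp
    (tendsto_measure_of_tendsto_indicator_of_isFiniteMeasure _ σ
      (fun y => measurableSet_Iic) fun p => ?_)
  by_cases hp : p ≤ x
  · filter_upwards [self_mem_nhdsWithin] with y hy
    simp [hp, hp.trans (le_of_lt hy)]
  · filter_upwards [nhdsWithin_le_nhds (Iio_mem_nhds (not_le.1 hp))] with y hy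
    simp only [mem_Iic]
    exact ⟨fun h => absurd h (not_le.2 hy), fun h => absurd h hp⟩

theorem tendsto_real_Iic_left (σ : Measure ℝ) [IsFiniteMeasure σ] (x : ℝ) :
    Tendsto (fun y => σ.real (Iic y)) (𝓝[<] x) (𝓝 (σ.real (Iio x))) := by
  refine (ENNReal.tendsto_toReal (measure_ne_top σ _)).comp
    (tendsto_measure_of_tendsto_indicator_of_isFiniteMeasure _ σ
      (fun y => measurableSet_Iic) fun p => ?_)
  by_cases hp : p < x
  · filter_upwards [nhdsWithin_le_nhds (Ioi_mem_nhds hp)] with y hy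
    simp only [mem_Iic, mem_Iio]
    exact ⟨fun _ => hp, fun _ => le_of_lt hy⟩
  · filter_upwards [self_mem_nhdsWithin] with y hy
    simp only [mem_Iic, mem_Iio]
    exact ⟨fun h => h.trans_lt hy, fun h => absurd h hp⟩

theorem real_Iic_eq_add (σ : Measure ℝ) [IsFiniteMeasure σ] (x : ℝ) :
    σ.real (Iic x) = σ.real (Iio x) + σ.real {x} := by
  rw [← Iio_union_right, measureReal_union (by simp) (measurableSet_singleton x)]

section Cumul

variable (c : ℝ) (σ κ : Measure ℝ) [IsFiniteMeasure σ] [IsFiniteMeasure κ]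

theorem tendsto_cumul_right (x : ℝ) :
    Tendsto (cumul c σ κ) (𝓝[>] x) (𝓝 (cumul c σ κ x)) :=
  tendsto_const_nhds.add ((tendsto_real_Iic_right σ x).sub (tendsto_real_Iic_right κ x))

theorem tendsto_cumul_left (x : ℝ) :
    Tendsto (cumul c σ κ) (𝓝[<] x)
      (𝓝 (cumul c σ κ x - (σ.real {x} - κ.real {x}))) := by
  have := (tendsto_const_nhds (x := c)).add
    ((tendsto_real_Iic_left σ x).sub (tendsto_real_Iic_left κ x))
  have h : cumul c σ κ x - (σ.real {x} - κ.real {x}) = c + (σ.real (Iio x) - κ.real (Iio x)) := by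
    rw [cumul, real_Iic_eq_add σ, real_Iic_eq_add κ]; ring
  rwa [h]

end Cumul

/-- A subset of full measure in `(a, b)` meets every one-sided neighbourhood. Closed conditions
known a.e. therefore pass to one-sided limits. -/
theorem frequently_nhdsGT_of_ae {a b : ℝ} {P : ℝ → Prop}
    (h : ∀ᵐ x ∂volume.restrict (Ioo a b), P x) {x : ℝ} (hx : x ∈ Ico a b) :
    ∃ᶠ y in 𝓝[>] x, P y := by
  intro hn
  obtain ⟨δ, hδ, hδP⟩ := (mem_nhdsGT_iff_exists_Ioo_subset' (lt_add_one x)).1 hn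
  rw [ae_restrict_iff' measurableSet_Ioo, ae_iff] at h
  have hsub : Ioo x (min δ b) ⊆ {y | ¬(y ∈ Ioo a b → P y)} := by
    intro y hy
    simp only [mem_ofPred_eq, Classical.not_imp]
    exact ⟨⟨hx.1.trans_lt hy.1, hy.2.trans_le (min_le_right _ _)⟩,
      hδP ⟨hy.1, hy.2.trans_le (min_le_left _ _)⟩⟩
  have := measure_mono_null hsub h
  rw [Real.volume_Ioo, ENNReal.ofReal_eq_zero] at this
  have h2 : x < min δ b := lt_min hδ hx.2
  linarith

theorem frequently_nhdsLT_of_ae {a b : ℝ} {P : ℝ → Prop}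
    (h : ∀ᵐ x ∂volume.restrict (Ioo a b), P x) {x : ℝ} (hx : x ∈ Ioc a b) :
    ∃ᶠ y in 𝓝[<] x, P y := by
  intro hn
  obtain ⟨δ, hδ, hδP⟩ := (mem_nhdsLT_iff_exists_Ioo_subset' (sub_one_lt x)).1 hn
  rw [ae_restrict_iff' measurableSet_Ioo, ae_iff] at h
  have hsub : Ioo (max δ a) x ⊆ {y | ¬(y ∈ Ioo a b → P y)} := by
    intro y hy
    simp only [mem_ofPred_eq, Classical.not_imp]
    exact ⟨⟨(le_max_right _ _).trans_lt hy.1, hy.2.trans_le hx.2⟩,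
      hδP ⟨(le_max_left _ _).trans_lt hy.1, hy.2⟩⟩
  have := measure_mono_null hsub h
  rw [Real.volume_Ioo, ENNReal.ofReal_eq_zero] at this
  have h2 : max δ a < x := max_lt hδ hx.1
  linarith

theorem cumul_eq_of_ae_eq {a b c c' : ℝ} {σ κ σ' κ' : Measure ℝ} [IsFiniteMeasure σ]
    [IsFiniteMeasure κ] [IsFiniteMeasure σ'] [IsFiniteMeasure κ']
    (h : cumul c σ κ =ᵐ[volume.restrict (Ioo a b)] cumul c' σ' κ') {x : ℝ} (hx : x ∈ Ico a b) :
    cumul c σ κ x = cumul c' σ' κ' x := by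
  have h1 := ((tendsto_cumul_right c σ κ x).sub (tendsto_cumul_right c' σ' κ' x))
  have h2 : ∃ᶠ y in 𝓝[>] x, cumul c σ κ y - cumul c' σ' κ' y ∈ ({0} : Set ℝ) :=
    frequently_nhdsGT_of_ae (h.mono fun y hy => by simp [hy]) hx
  have := isClosed_singleton.mem_of_frequently_of_tendsto h2 h1
  simpa [sub_eq_zero] using this

theorem real_Iic_of_le {a b : ℝ} {σ : Measure ℝ} [IsFiniteMeasure σ] (h : σ (Ioo a b)ᶜ = 0) {x : ℝ}
    (hx : x ≤ a) : σ.real (Iic x) = 0 := by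
  rw [measureReal_eq_zero_iff]
  exact measure_mono_null (t := (Ioo a b)ᶜ)
    (fun y (hy : y ≤ x) hy' => absurd (hy'.1.trans_le hy) (not_lt.2 hx)) h

theorem measure_eq_measure_inter_Ioo {a b : ℝ} {σ : Measure ℝ} (h : σ (Ioo a b)ᶜ = 0)
    (s : Set ℝ) : σ s = σ (s ∩ Ioo a b) := by
  refine (measure_inter_conull' ?_).symm
  exact measure_mono_null (fun x hx => hx.2) h

theorem real_Iic_of_ge {a b : ℝ} {σ : Measure ℝ} [IsFiniteMeasure σ] (h : σ (Ioo a b)ᶜ = 0) {x : ℝ}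
    (hx : b ≤ x) : σ.real (Iic x) = σ.real (Iio b) := by
  rw [measureReal_def, measureReal_def, measure_eq_measure_inter_Ioo h,
    measure_eq_measure_inter_Ioo h (Iio b)]
  congr 2
  ext y
  simp only [mem_inter_iff, mem_Iic, mem_Ioo, mem_Iio]
  constructor <;> rintro ⟨h1, h2, h3⟩ <;> refine ⟨?_, h2, h3⟩ <;> linarith

/-- Right continuity turns the a.e. identity into equality at every point of `[a, b)`; at `a` both
distribution functions vanish, so the constants agree. The conclusion is `σ - κ = σ' - κ'`, written
without subtraction of measures. -/
theorem add_eq_add_of_cumul_ae_eq {a b c c' : ℝ} (hab : a < b) {σ κ σ' κ' : Measure ℝ}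
    [IsFiniteMeasure σ] [IsFiniteMeasure κ] [IsFiniteMeasure σ'] [IsFiniteMeasure κ']
    (h1 : σ (Ioo a b)ᶜ = 0) (h2 : κ (Ioo a b)ᶜ = 0) (h3 : σ' (Ioo a b)ᶜ = 0)
    (h4 : κ' (Ioo a b)ᶜ = 0)
    (h : cumul c σ κ =ᵐ[volume.restrict (Ioo a b)] cumul c' σ' κ') :
    σ + κ' = σ' + κ := by
  have key : ∀ x ∈ Ico a b,
      σ.real (Iic x) + κ'.real (Iic x) = σ'.real (Iic x) + κ.real (Iic x) := by
    have ha := cumul_eq_of_ae_eq h (left_mem_Ico.2 hab)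
    intro x hx
    have hx' := cumul_eq_of_ae_eq h hx
    unfold cumul at ha hx'
    rw [real_Iic_of_le h1 le_rfl, real_Iic_of_le h2 le_rfl, real_Iic_of_le h3 le_rfl,
      real_Iic_of_le h4 le_rfl] at ha
    linarith
  -- The functions are not compared at `b` itself; the total masses come from the left limit there.
  have keyb : σ.real (Iio b) + κ'.real (Iio b) = σ'.real (Iio b) + κ.real (Iio b) := by
    refine tendsto_nhds_unique ((tendsto_real_Iic_left σ b).add (tendsto_real_Iic_left κ' b))
      (((tendsto_real_Iic_left σ' b).add (tendsto_real_Iic_left κ b)).congr' ?_)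
    filter_upwards [Ioo_mem_nhdsLT hab] with y hy
    exact (key y ⟨hy.1.le, hy.2⟩).symm
  refine Measure.ext_of_Iic _ _ fun x => ?_
  have : (σ + κ').real (Iic x) = (σ' + κ).real (Iic x) := by
    rw [measureReal_add_apply, measureReal_add_apply]
    rcases lt_or_ge x a with hxa | hxa
    · rw [real_Iic_of_le h1 hxa.le, real_Iic_of_le h2 hxa.le, real_Iic_of_le h3 hxa.le,
        real_Iic_of_le h4 hxa.le]
    rcases lt_or_ge x b with hxb | hxb
    · exact key x ⟨hxa, hxb⟩
    · rw [real_Iic_of_ge h1 hxb, real_Iic_of_ge h2 hxb, real_Iic_of_ge h3 hxb,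
        real_Iic_of_ge h4 hxb, keyb]
  exact (measureReal_eq_measureReal_iff).1 this

/-! ### Approximate one-sided limits and the jump set. -/

section Trace

/-- Approximate limits along a family of sets shrinking as `r ↓ 0`. -/
theorem tendsto_average_abs_sub {S : ℝ → Set ℝ} {u : ℝ → ℝ} {l : ℝ}
    (hS : ∀ᶠ r in 𝓝[>] (0 : ℝ), 0 < volume (S r) ∧ volume (S r) < ⊤)
    (h : ∀ ε > 0, ∀ᶠ r in 𝓝[>] (0 : ℝ), ∀ᵐ y ∂volume.restrict (S r), |u y - l| ≤ ε) :
    Tendsto (fun r : ℝ => ⨍ y in S r, |u y - l|) (𝓝[>] 0) (𝓝 0) := by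
  rw [Metric.tendsto_nhds]
  intro ε hε
  filter_upwards [hS, h (ε / 2) (half_pos hε)] with r hr hrε
  have hpos : 0 < volume.real (S r) := ENNReal.toReal_pos hr.1.ne' hr.2.ne
  rw [dist_zero_right, setAverage_eq, norm_smul, norm_inv, Real.norm_of_nonneg hpos.le]
  have h1 : ‖∫ y in S r, |u y - l|‖ ≤ ε / 2 * volume.real (S r) := by
    refine norm_setIntegral_le_of_norm_le_const_ae hr.2 ?_
    filter_upwards [hrε] with y hy
    simpa using hy
  calc (volume.real (S r))⁻¹ * ‖∫ y in S r, |u y - l|‖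
      ≤ (volume.real (S r))⁻¹ * (ε / 2 * volume.real (S r)) := by gcongr
    _ = ε / 2 := by field_simp
    _ < ε := half_lt_self hε

/-- Average the triangle inequality `|l - l'| ≤ |u - l| + |u - l'|` over `S r`. -/
theorem eq_of_tendsto_average_abs_sub {S : ℝ → Set ℝ} {u : ℝ → ℝ} {l l' : ℝ}
    (hS : ∀ᶠ r in 𝓝[>] (0 : ℝ), 0 < volume (S r) ∧ volume (S r) < ⊤)
    (hu : ∀ᶠ r in 𝓝[>] (0 : ℝ), IntegrableOn u (S r))
    (h : Tendsto (fun r : ℝ => ⨍ y in S r, |u y - l|) (𝓝[>] 0) (𝓝 0))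
    (h' : Tendsto (fun r : ℝ => ⨍ y in S r, |u y - l'|) (𝓝[>] 0) (𝓝 0)) : l = l' := by
  have h0 := h.add h'
  rw [add_zero] at h0
  have : |l - l'| ≤ 0 := by
    refine ge_of_tendsto h0 ?_
    filter_upwards [hS, hu] with r hr hur
    have hpos : 0 < volume.real (S r) := ENNReal.toReal_pos hr.1.ne' hr.2.ne
    have hi : ∀ l : ℝ, IntegrableOn (fun y => |u y - l|) (S r) := fun l =>
      (Integrable.sub hur (integrableOn_const hr.2.ne)).abs
    rw [setAverage_eq, setAverage_eq, ← smul_add, ← integral_add (hi l) (hi l')]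
    have h1 : ∫ y in S r, |l - l'| ≤ ∫ y in S r, |u y - l| + |u y - l'| := by
      refine integral_mono (integrableOn_const hr.2.ne) ((hi l).add (hi l')) fun y => ?_
      calc |l - l'| = |(u y - l') - (u y - l)| := by congr 1; ring
        _ ≤ |u y - l'| + |u y - l| := abs_sub _ _
        _ = _ := add_comm _ _
    rw [setIntegral_const, smul_eq_mul] at h1
    rw [smul_eq_mul, ← div_eq_inv_mul, le_div_iff₀ hpos, mul_comm]
    exact h1
  exact sub_eq_zero.1 (abs_eq_zero.1 (le_antisymm this (abs_nonneg _)))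

variable {a b : ℝ} {u : ℝ → ℝ} {x l l' : ℝ}

theorem eventually_volume_Ioo_right (x : ℝ) : ∀ᶠ r in 𝓝[>] (0 : ℝ),
    0 < volume (Ioo x (x + r)) ∧ volume (Ioo x (x + r)) < ⊤ := by
  filter_upwards [self_mem_nhdsWithin] with r hr
  simpa using hr

theorem eventually_volume_Ioo_left (x : ℝ) : ∀ᶠ r in 𝓝[>] (0 : ℝ),
    0 < volume (Ioo (x - r) x) ∧ volume (Ioo (x - r) x) < ⊤ := by
  filter_upwards [self_mem_nhdsWithin] with r hr
  simpa using hr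

theorem eventually_Ioo_right_subset (hx : x ∈ Ioo a b) :
    ∀ᶠ r in 𝓝[>] (0 : ℝ), Ioo x (x + r) ⊆ Ioo a b := by
  filter_upwards [Ioo_mem_nhdsGT (sub_pos.2 hx.2)] with r hr
  have := hr.2
  exact Ioo_subset_Ioo hx.1.le (by linarith)

theorem eventually_Ioo_left_subset (hx : x ∈ Ioo a b) :
    ∀ᶠ r in 𝓝[>] (0 : ℝ), Ioo (x - r) x ⊆ Ioo a b := by
  filter_upwards [Ioo_mem_nhdsGT (sub_pos.2 hx.1)] with r hr
  have := hr.2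
  exact Ioo_subset_Ioo (by linarith) hx.2.le

theorem IsRightTrace.unique (hu : IntegrableOn u (Ioo a b)) (hx : x ∈ Ioo a b)
    (h : IsRightTrace u x l) (h' : IsRightTrace u x l') : l = l' :=
  eq_of_tendsto_average_abs_sub (eventually_volume_Ioo_right x)
    ((eventually_Ioo_right_subset hx).mono fun _ hr => hu.mono_set hr) h h'

theorem IsLeftTrace.unique (hu : IntegrableOn u (Ioo a b)) (hx : x ∈ Ioo a b)
    (h : IsLeftTrace u x l) (h' : IsLeftTrace u x l') : l = l' :=
  eq_of_tendsto_average_abs_sub (eventually_volume_Ioo_left x)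
    ((eventually_Ioo_left_subset hx).mono fun _ hr => hu.mono_set hr) h h'

theorem isRightTrace_of_tendsto {V : ℝ → ℝ} (hx : x ∈ Ioo a b)
    (huV : u =ᵐ[volume.restrict (Ioo a b)] V) (hV : Tendsto V (𝓝[>] x) (𝓝 l)) :
    IsRightTrace u x l := by
  refine tendsto_average_abs_sub (eventually_volume_Ioo_right x) fun ε hε => ?_
  obtain ⟨δ, hδ, hδV⟩ := (mem_nhdsGT_iff_exists_Ioo_subset' (lt_add_one x)).1
    ((Metric.tendsto_nhds.1 hV) ε hε)
  filter_upwards [eventually_Ioo_right_subset hx, Ioo_mem_nhdsGT (sub_pos.2 hδ)] with r hr hrδ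
  filter_upwards [ae_restrict_of_ae_restrict_of_subset hr huV,
    ae_restrict_mem measurableSet_Ioo] with y hy hyI
  rw [hy]
  have h2 := hrδ.2
  have : y ∈ Ioo x δ := ⟨hyI.1, by have := hyI.2; linarith⟩
  exact le_of_lt (hδV this)

theorem isLeftTrace_of_tendsto {V : ℝ → ℝ} (hx : x ∈ Ioo a b)
    (huV : u =ᵐ[volume.restrict (Ioo a b)] V) (hV : Tendsto V (𝓝[<] x) (𝓝 l)) :
    IsLeftTrace u x l := by
  refine tendsto_average_abs_sub (eventually_volume_Ioo_left x) fun ε hε => ?_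
  obtain ⟨δ, hδ, hδV⟩ := (mem_nhdsLT_iff_exists_Ioo_subset' (sub_one_lt x)).1
    ((Metric.tendsto_nhds.1 hV) ε hε)
  filter_upwards [eventually_Ioo_left_subset hx, Ioo_mem_nhdsGT (sub_pos.2 hδ)] with r hr hrδ
  filter_upwards [ae_restrict_of_ae_restrict_of_subset hr huV,
    ae_restrict_mem measurableSet_Ioo] with y hy hyI
  rw [hy]
  have h2 := hrδ.2
  have : y ∈ Ioo δ x := ⟨by have := hyI.1; linarith, hyI.2⟩
  exact le_of_lt (hδV this)

end Trace

section TraceCumul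

variable {a b c : ℝ} {u : ℝ → ℝ} {σ κ : Measure ℝ} [IsFiniteMeasure σ] [IsFiniteMeasure κ]

theorem isRightTrace_iff (hu : u =ᵐ[volume.restrict (Ioo a b)] cumul c σ κ) {x : ℝ}
    (hx : x ∈ Ioo a b) {l : ℝ} : IsRightTrace u x l ↔ l = cumul c σ κ x := by
  have h0 := isRightTrace_of_tendsto hx hu (tendsto_cumul_right c σ κ x)
  refine ⟨fun h => ?_, fun h => h ▸ h0⟩
  exact h.unique ((integrable_congr hu).2 (integrableOn_cumul a b c σ κ)) hx h0

theorem isLeftTrace_iff (hu : u =ᵐ[volume.restrict (Ioo a b)] cumul c σ κ) {x : ℝ}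
    (hx : x ∈ Ioo a b) {l : ℝ} :
    IsLeftTrace u x l ↔ l = cumul c σ κ x - (σ.real {x} - κ.real {x}) := by
  have h0 := isLeftTrace_of_tendsto hx hu (tendsto_cumul_left c σ κ x)
  refine ⟨fun h => ?_, fun h => h ▸ h0⟩
  exact h.unique ((integrable_congr hu).2 (integrableOn_cumul a b c σ κ)) hx h0

theorem jumpSet_eq (hu : u =ᵐ[volume.restrict (Ioo a b)] cumul c σ κ) :
    jumpSet a b u = {x | x ∈ Ioo a b ∧ σ.real {x} ≠ κ.real {x}} := by
  ext x
  refine and_congr_right fun hx => ?_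
  simp only [isLeftTrace_iff hu hx, isRightTrace_iff hu hx]
  constructor
  · rintro ⟨l, r, hne, rfl, rfl⟩ h
    exact hne (by rw [h]; ring)
  · intro h
    refine ⟨_, _, fun h' => h ?_, rfl, rfl⟩
    linarith

theorem rightTrace_sub_leftTrace (hu : u =ᵐ[volume.restrict (Ioo a b)] cumul c σ κ) {x : ℝ}
    (hx : x ∈ Ioo a b) : rightTrace u x - leftTrace u x = σ.real {x} - κ.real {x} := by
  have h1 : IsRightTrace u x (rightTrace u x) :=
    Classical.epsilon_spec ⟨_, (isRightTrace_iff hu hx).2 rfl⟩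
  have h2 : IsLeftTrace u x (leftTrace u x) :=
    Classical.epsilon_spec ⟨_, (isLeftTrace_iff hu hx).2 rfl⟩
  rw [(isRightTrace_iff hu hx).1 h1, (isLeftTrace_iff hu hx).1 h2]
  ring

end TraceCumul

/-! ### Functions of bounded variation as distribution functions. -/

theorem IsDistribDeriv.exists_ae_eq_cumul {a b : ℝ} (hab : a < b) {u : ℝ → ℝ}
    (hu : IntegrableOn u (Ioo a b)) {μ : SignedMeasure ℝ} (h : IsDistribDeriv a b u μ) :
    ∃ c, u =ᵐ[volume.restrict (Ioo a b)] cumul c μ.toJordanDecomposition.posPart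
      μ.toJordanDecomposition.negPart := by
  set σ := μ.toJordanDecomposition.posPart
  set κ := μ.toJordanDecomposition.negPart
  obtain ⟨k, hk⟩ := ae_const_of_integral_mul_deriv_eq_zero hab
    (w := fun x => u x - cumul 0 σ κ x) (Integrable.sub hu (integrableOn_cumul a b 0 σ κ)) (by
      intro φ h1 h2 h3
      have hφ : Continuous (deriv φ) := h1.continuous_deriv (by simp)
      obtain ⟨B, hB⟩ := h2.deriv.exists_bound_of_continuous hφ
      simp_rw [sub_mul]
      rw [integral_sub (hu.mul_bdd (c := B) hφ.aestronglyMeasurable (Eventually.of_forall hB))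
        ((integrableOn_cumul a b 0 σ κ).mul_bdd (c := B) hφ.aestronglyMeasurable
          (Eventually.of_forall hB)),
        h.2 φ h1 h2 h3, setIntegral_cumul_mul_deriv a b 0 σ κ h1 h2 h3, sub_self])
  refine ⟨k, hk.mono fun x hx => ?_⟩
  simp only [cumul] at hx ⊢
  linarith

theorem add_eq_add_of_toSignedMeasure_sub_eq {σ κ σ' κ' : Measure ℝ}
    [IsFiniteMeasure σ] [IsFiniteMeasure κ] [IsFiniteMeasure σ'] [IsFiniteMeasure κ'] :
    σ.toSignedMeasure - κ.toSignedMeasure = σ'.toSignedMeasure - κ'.toSignedMeasure ↔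
      σ + κ' = σ' + κ := by
  constructor
  · intro h
    ext s hs
    have h1 := congrArg (fun ν : SignedMeasure ℝ => ν s) h
    simp only [Measure.toSignedMeasure_sub_apply hs] at h1
    rw [← measureReal_eq_measureReal_iff, measureReal_add_apply, measureReal_add_apply]
    linarith
  · intro h
    ext s hs
    have h1 : (σ + κ').real s = (σ' + κ).real s := by rw [h]
    rw [measureReal_add_apply, measureReal_add_apply] at h1
    rw [Measure.toSignedMeasure_sub_apply hs, Measure.toSignedMeasure_sub_apply hs]
    linarith

/-- Cancellation between `σ` and `κ` can only lower the variation. Hence competitors may be built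
from pairs that are not mutually singular. -/
theorem totalVariation_toSignedMeasure_sub_le (σ κ : Measure ℝ) [IsFiniteMeasure σ]
    [IsFiniteMeasure κ] :
    (σ.toSignedMeasure - κ.toSignedMeasure).totalVariation ≤ σ + κ := by
  rw [SignedMeasure.totalVariation, Measure.toJordanDecomposition_toSignedMeasure_sub,
    Measure.jordanDecompositionOfToSignedMeasureSub_posPart,
    Measure.jordanDecompositionOfToSignedMeasureSub_negPart]
  exact add_le_add Measure.sub_le Measure.sub_le

theorem isDistribDeriv_of_ae_eq_cumul {a b c : ℝ} {u : ℝ → ℝ} {σ κ : Measure ℝ} [IsFiniteMeasure σ]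
    [IsFiniteMeasure κ] (h1 : σ (Ioo a b)ᶜ = 0) (h2 : κ (Ioo a b)ᶜ = 0)
    (hu : u =ᵐ[volume.restrict (Ioo a b)] cumul c σ κ) :
    IsDistribDeriv a b u (σ.toSignedMeasure - κ.toSignedMeasure) := by
  set μ := σ.toSignedMeasure - κ.toSignedMeasure with hμ
  refine ⟨measure_mono_null (le_refl _) (le_antisymm
    ((totalVariation_toSignedMeasure_sub_le σ κ _).trans (by simp [h1, h2])) bot_le), ?_⟩
  intro φ g1 g2 g3
  have e1 : ∫ x in Ioo a b, u x * deriv φ x = ∫ x in Ioo a b, cumul c σ κ x * deriv φ x :=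
    integral_congr_ae (hu.mono fun x hx => by simp only [hx])
  rw [e1, setIntegral_cumul_mul_deriv a b c σ κ g1 g2 g3]
  -- The Jordan parts of `μ` may differ from `σ` and `κ`, but this balance shows that test functions
  -- have the same integrals.
  have e2 : σ + μ.toJordanDecomposition.negPart = μ.toJordanDecomposition.posPart + κ :=
    add_eq_add_of_toSignedMeasure_sub_eq.1 (by
      rw [← hμ]; exact (SignedMeasure.toSignedMeasure_toJordanDecomposition μ).symm)
  have hi : ∀ (σ : Measure ℝ) [IsFiniteMeasure σ], Integrable φ σ := fun σ _ =>
    g1.continuous.integrable_of_hasCompactSupport g2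
  have e3 := congrArg (fun ν : Measure ℝ => ∫ x, φ x ∂ν) e2
  simp only [integral_add_measure (hi _) (hi _)] at e3
  linarith

theorem memBV_of_ae_eq_cumul {a b c : ℝ} {u : ℝ → ℝ} {σ κ : Measure ℝ} [IsFiniteMeasure σ]
    [IsFiniteMeasure κ] (h1 : σ (Ioo a b)ᶜ = 0) (h2 : κ (Ioo a b)ᶜ = 0)
    (hu : u =ᵐ[volume.restrict (Ioo a b)] cumul c σ κ) : MemBV a b u :=
  ⟨(integrable_congr hu).2 (integrableOn_cumul a b c σ κ), _,
    isDistribDeriv_of_ae_eq_cumul h1 h2 hu⟩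

theorem isDistribDeriv_distribDeriv {a b : ℝ} {u : ℝ → ℝ} (h : MemBV a b u) :
    IsDistribDeriv a b u (distribDeriv a b u) := by
  rw [distribDeriv, dif_pos h.2]
  exact h.2.choose_spec

/-- Since `distribDeriv` is a choice, uniqueness is what allows it to be computed for explicit
competitors. -/
theorem IsDistribDeriv.unique {a b : ℝ} (hab : a < b) {u : ℝ → ℝ}
    (hu : IntegrableOn u (Ioo a b)) {μ ν : SignedMeasure ℝ} (hμ : IsDistribDeriv a b u μ)
    (hν : IsDistribDeriv a b u ν) : μ = ν := by
  obtain ⟨c, hc⟩ := hμ.exists_ae_eq_cumul hab hu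
  obtain ⟨d, hd⟩ := hν.exists_ae_eq_cumul hab hu
  have hz : ∀ {μ : SignedMeasure ℝ}, IsDistribDeriv a b u μ →
      μ.toJordanDecomposition.posPart (Ioo a b)ᶜ = 0 ∧
      μ.toJordanDecomposition.negPart (Ioo a b)ᶜ = 0 := by
    intro μ h
    have := h.1
    rw [SignedMeasure.totalVariation, Measure.add_apply, add_eq_zero] at this
    exact this
  have := add_eq_add_of_cumul_ae_eq hab (hz hμ).1 (hz hμ).2 (hz hν).1 (hz hν).2
    (hc.symm.trans hd)
  rw [← add_eq_add_of_toSignedMeasure_sub_eq] at this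
  rw [← SignedMeasure.toSignedMeasure_toJordanDecomposition μ,
    ← SignedMeasure.toSignedMeasure_toJordanDecomposition ν]
  exact this

theorem distribDeriv_eq_of_ae_eq_cumul {a b c : ℝ} (hab : a < b) {u : ℝ → ℝ} {σ κ : Measure ℝ}
    [IsFiniteMeasure σ] [IsFiniteMeasure κ] (h1 : σ (Ioo a b)ᶜ = 0) (h2 : κ (Ioo a b)ᶜ = 0)
    (hu : u =ᵐ[volume.restrict (Ioo a b)] cumul c σ κ) :
    distribDeriv a b u = σ.toSignedMeasure - κ.toSignedMeasure :=
  IsDistribDeriv.unique hab ((integrable_congr hu).2 (integrableOn_cumul a b c σ κ))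
    (isDistribDeriv_distribDeriv (memBV_of_ae_eq_cumul h1 h2 hu))
    (isDistribDeriv_of_ae_eq_cumul h1 h2 hu)

/-! ### Consequences of the conditions on `K`. -/

section CondK

variable {K : ℝ → ℝ}

theorem CondK1.mono (hK : CondK1 K) {x y : ℝ} (hx : 0 ≤ x) (hxy : x ≤ y) : K x ≤ K y :=
  hK.2.1.monotoneOn hx (hx.trans hxy) hxy

theorem CondK1.nonneg (hK : CondK1 K) {x : ℝ} (hx : 0 ≤ x) : 0 ≤ K x :=
  hK.2.2 ▸ hK.mono le_rfl hx

theorem CondK2.add_le (hK : CondK2 K) {x y : ℝ} (hx : 0 ≤ x) (hy : 0 ≤ y) :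
    K (x + y) ≤ K x + K y := by
  -- The extra `1` keeps the bound positive when `x = y = 0`.
  obtain ⟨C, hC, h⟩ := hK (x + y + 1) (by positivity)
  have := h x y hx hy (by linarith)
  have h2 : 0 ≤ C * x * y := by positivity
  linarith

/-- Split `ρ` into halves `n` times. The `k`-th halving gains `C/2 · ρ² / 2 ^ k`, and these gains
form a geometric sum. -/
theorem IsMergeConst.le_two_pow_mul {M C : ℝ} (h : IsMergeConst K M C) (n : ℕ) {ρ : ℝ}
    (h0 : 0 ≤ ρ) (hM : ρ ≤ M) :
    K ρ ≤ 2 ^ n * K (ρ / 2 ^ n) - C / 2 * ρ ^ 2 * (1 - 1 / 2 ^ n) := by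
  induction n with
  | zero => simp
  | succ n ih =>
    have hle : ρ / 2 ^ n ≤ M := (div_le_self h0 (one_le_pow₀ one_le_two)).trans hM
    have := h.2 (ρ / 2 ^ (n + 1)) (ρ / 2 ^ (n + 1)) (by positivity) (by positivity)
      (by convert hle using 1; field_simp; ring)
    have e : ρ / 2 ^ (n + 1) + ρ / 2 ^ (n + 1) = ρ / 2 ^ n := by field_simp; ring
    rw [e] at this
    have h3 := mul_le_mul_of_nonneg_left this (by positivity : (0 : ℝ) ≤ 2 ^ n)
    have e2 : (2 : ℝ) ^ n * (K (ρ / 2 ^ n) + C * (ρ / 2 ^ (n + 1)) * (ρ / 2 ^ (n + 1)))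
      = 2 ^ n * K (ρ / 2 ^ n) + C / 2 * ρ ^ 2 * (1 / 2 ^ (n + 1)) := by
      field_simp; ring
    have e3 : (2 : ℝ) ^ n * (K (ρ / 2 ^ (n + 1)) + K (ρ / 2 ^ (n + 1)))
      = 2 ^ (n + 1) * K (ρ / 2 ^ (n + 1)) := by ring
    have e4 : (1 : ℝ) / 2 ^ n = 1 / 2 ^ (n + 1) + 1 / 2 ^ (n + 1) := by field_simp; ring
    rw [e2, e3] at h3
    rw [e4] at ih
    linarith

/-- Let the number of halvings tend to infinity; by (K3), `2 ^ n * K (ρ / 2 ^ n)` tends to `ρ`. This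
is the gain from concentrating diffuse mass `ρ` into one jump. -/
theorem IsMergeConst.le_sub (hK1 : CondK1 K) (hK3 : CondK3 K) {M C : ℝ} (h : IsMergeConst K M C)
    {ρ : ℝ} (h0 : 0 ≤ ρ) (hM : ρ ≤ M) : K ρ ≤ ρ - C / 2 * ρ ^ 2 := by
  rcases h0.eq_or_lt with rfl | hpos
  · simp [hK1.2.2]
  have hhalf : Tendsto (fun n : ℕ => (1 : ℝ) / 2 ^ n) atTop (𝓝 0) := by
    simpa using tendsto_pow_atTop_nhds_zero_of_lt_one (r := (1 / 2 : ℝ)) (by norm_num) (by norm_num)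
  have hlim : Tendsto (fun n : ℕ => ρ / 2 ^ n) atTop (𝓝[>] 0) := by
    refine tendsto_nhdsWithin_iff.2 ⟨?_, Eventually.of_forall fun n => ?_⟩
    · simpa [div_eq_mul_inv] using hhalf.const_mul ρ
    · exact div_pos hpos (by positivity)
  have h1 := (hK3.comp hlim).const_mul ρ
  have h2 := h1.sub ((hhalf.const_sub 1).const_mul (C / 2 * ρ ^ 2))
  simp only [sub_zero, mul_one] at h2
  refine ge_of_tendsto' h2 fun n => ?_
  have := h.le_two_pow_mul n h0 hM
  have e : ρ * (((fun ρ => K ρ / ρ) ∘ fun n : ℕ => ρ / 2 ^ n) n) = 2 ^ n * K (ρ / 2 ^ n) := by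
    rw [Function.comp_apply]
    field_simp
  rw [e]
  exact this

theorem le_self_of_condK (hK1 : CondK1 K) (hK2 : CondK2 K) (hK3 : CondK3 K) {ρ : ℝ} (h0 : 0 ≤ ρ) :
    K ρ ≤ ρ := by
  obtain ⟨C, hC⟩ := hK2 (ρ + 1) (by positivity)
  have := hC.le_sub hK1 hK3 h0 (by linarith)
  have h2 : 0 ≤ C / 2 * ρ ^ 2 := by have := hC.1; positivity
  linarith

/-- Merging one jump at a time gains `C` times the sum of `p i * p j` over pairs, which is half of
the square of the sum minus the sum of the squares. -/
theorem IsMergeConst.le_sum (hK1 : CondK1 K) {M C : ℝ} (h : IsMergeConst K M C) {ι : Type*}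
    (s : Finset ι) {p : ι → ℝ} (hp : ∀ i, 0 ≤ p i) (hM : ∑ i ∈ s, p i ≤ M) :
    K (∑ i ∈ s, p i) + C / 2 * ((∑ i ∈ s, p i) ^ 2 - ∑ i ∈ s, p i ^ 2) ≤ ∑ i ∈ s, K (p i) := by
  classical
  induction s using Finset.induction_on with
  | empty => simp [hK1.2.2]
  | insert i s hi ih =>
    rw [Finset.sum_insert hi] at hM
    rw [Finset.sum_insert hi, Finset.sum_insert hi, Finset.sum_insert hi]
    have h1 := ih (by have := hp i; linarith)
    have h2 := h.2 (p i) (∑ i ∈ s, p i) (hp i) (Finset.sum_nonneg fun i _ => hp i) hM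
    nlinarith

/-- Near `0` the quotient `K ρ / ρ` exceeds `1/2`; farther out, monotonicity bounds `K` below by a
positive constant. -/
theorem exists_linear_lower_bound (hK1 : CondK1 K) (hK3 : CondK3 K) {M : ℝ} (hM : 0 < M) :
    ∃ c, 0 < c ∧ ∀ ρ ∈ Icc 0 M, c * ρ ≤ K ρ := by
  have h1 : ∀ᶠ ρ in 𝓝[>] (0 : ℝ), 1 / 2 < K ρ / ρ :=
    hK3.eventually (lt_mem_nhds (by norm_num))
  obtain ⟨δ, hδ, hδK⟩ := (mem_nhdsGT_iff_exists_Ioo_subset' (zero_lt_one (α := ℝ))).1 h1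
  have hδ' : (0 : ℝ) < δ := hδ
  have hKδ : 0 < K (δ / 2) := by
    have := hK1.2.1 (mem_Ici.2 le_rfl) (mem_Ici.2 (half_pos hδ').le) (half_pos hδ')
    rwa [hK1.2.2] at this
  refine ⟨min (1 / 2) (K (δ / 2) / M), lt_min (by norm_num) (div_pos hKδ hM), fun ρ hρ => ?_⟩
  rcases hρ.1.eq_or_lt with rfl | hpos
  · simp [hK1.2.2]
  by_cases hlt : ρ < δ
  · have : 1 / 2 < K ρ / ρ := hδK ⟨hpos, hlt⟩
    rw [lt_div_iff₀ hpos] at this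
    exact (mul_le_mul_of_nonneg_right (min_le_left _ _) hpos.le).trans this.le
  · calc min (1 / 2) (K (δ / 2) / M) * ρ ≤ K (δ / 2) / M * M :=
        mul_le_mul (min_le_right _ _) hρ.2 hpos.le (by positivity)
      _ = K (δ / 2) := by field_simp
      _ ≤ K ρ := hK1.mono (by positivity) (by linarith)

end CondK

/-! ### Atoms of finite measures. -/

section Atoms

theorem tsum_measure_singleton_le (σ : Measure ℝ) : ∑' x, σ {x} ≤ σ univ := by
  refine (tsum_meas_le_meas_iUnion_of_disjoint σ (fun x => measurableSet_singleton x) ?_).trans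
    (measure_mono (subset_univ _))
  intro x y hxy
  simpa [Function.onFun] using hxy

theorem measure_nonatoms_diff (σ : Measure ℝ) {s : Set ℝ} (hs : s.Countable) :
    σ ({x | σ {x} = 0} \ s) = σ {x | σ {x} = 0} := by
  have h0 : σ ({x | σ {x} = 0} ∩ s) = 0 := by
    have hc : ({x | σ {x} = 0} ∩ s).Countable := hs.mono inter_subset_right
    rw [← biUnion_of_singleton ({x | σ {x} = 0} ∩ s), measure_biUnion_null_iff hc]
    exact fun x hx => hx.1
  rw [← sdiff_self_inter, measure_sdiff_null h0]

variable (σ : Measure ℝ) [IsFiniteMeasure σ]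

theorem countable_atoms : {x | σ {x} ≠ 0}.Countable :=
  Summable.countable_support_ennreal
    ((tsum_measure_singleton_le σ).trans_lt (measure_lt_top σ _)).ne

theorem measurableSet_nonatoms : MeasurableSet {x | σ {x} = 0} := by
  have := (countable_atoms σ).measurableSet.compl
  convert this using 1
  ext x; simp

theorem measure_nonatoms_add_tsum : σ {x | σ {x} = 0} + ∑' x, σ {x} = σ univ := by
  have h1 : ∑' x, σ {x} = σ {x | σ {x} ≠ 0} := by
    have := measure_biUnion (μ := σ) (countable_atoms σ) (f := fun x => {x})
      (fun x _ y _ hxy => by simpa [Function.onFun] using hxy)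
      (fun x _ => measurableSet_singleton x)
    rw [biUnion_of_singleton] at this
    rw [this]
    exact (tsum_subtype_eq_of_support_subset (f := fun x => σ {x}) fun x hx => hx).symm
  rw [h1, ← measure_add_measure_compl (measurableSet_nonatoms σ)]
  rfl

omit [IsFiniteMeasure σ] in
theorem nonatoms_add_eq (κ : Measure ℝ) :
    {x | (σ + κ) {x} = 0} = {x | σ {x} = 0} \ {x | κ {x} ≠ 0} := by
  ext x
  simp

theorem hasSum_real_singleton :
    HasSum (fun x => σ.real {x}) (σ.real univ - σ.real {x | σ {x} = 0}) := by
  have h := measure_nonatoms_add_tsum σ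
  have hne : ∑' x, σ {x} ≠ ⊤ := ((tsum_measure_singleton_le σ).trans_lt (measure_lt_top σ _)).ne
  have hs := ENNReal.hasSum_toReal hne
  have h' := congrArg ENNReal.toReal h
  rw [ENNReal.toReal_add (measure_ne_top _ _) hne,
    ENNReal.tsum_toReal_eq fun x => measure_ne_top σ {x}] at h'
  have e : σ.real univ - σ.real {x | σ {x} = 0} = ∑' x, (σ {x}).toReal :=
    sub_eq_of_eq_add' h'.symm
  rw [e]
  exact hs

theorem real_singleton_le (x : ℝ) : σ.real {x} ≤ σ.real univ := measureReal_mono (subset_univ _)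

theorem summable_real_singleton_sq : Summable fun x => σ.real {x} ^ 2 := by
  refine Summable.of_nonneg_of_le (fun x => sq_nonneg _) (fun x => ?_)
    ((hasSum_real_singleton σ).summable.mul_left (σ.real univ))
  rw [sq]
  exact mul_le_mul_of_nonneg_right (real_singleton_le σ x) measureReal_nonneg

end Atoms

/-! ### The `K`-variation of a measure. -/

/-- The `K`-variation of a measure: every atom is charged the value of `K` at its mass, and the
rest its mass. -/
noncomputable def varK (K : ℝ → ℝ) (σ : Measure ℝ) : ℝ≥0∞ :=
  σ {x | σ {x} = 0} + ∑' x, ENNReal.ofReal (K (σ.real {x}))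

section VarK

variable {K : ℝ → ℝ} (hK1 : CondK1 K) (hK2 : CondK2 K) (hK3 : CondK3 K)
  (σ κ : Measure ℝ) [IsFiniteMeasure σ] [IsFiniteMeasure κ]
include hK1

omit [IsFiniteMeasure σ] in
theorem varK_mono (h : σ ≤ κ) : varK K σ ≤ varK K κ := by
  unfold varK
  gcongr ?_ + ∑' x, ?_ with x
  -- A point without `σ`-mass may be an atom of `κ`; such points are countably many, hence
  -- `σ`-negligible among the non-atoms of `σ`.
  · rw [← measure_nonatoms_diff σ (countable_atoms κ)]
    refine (measure_mono ?_).trans (h _)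
    intro x hx
    simpa using hx.2
  · exact ENNReal.ofReal_le_ofReal (hK1.mono measureReal_nonneg
      (ENNReal.toReal_mono (measure_ne_top _ _) (h _)))

theorem varK_add_of_mutuallySingular (h : σ ⟂ₘ κ) : varK K (σ + κ) = varK K σ + varK K κ := by
  have h0 : ∀ x, σ {x} = 0 ∨ κ {x} = 0 := by
    obtain ⟨s, -, h1, h2⟩ := h
    intro x
    by_cases hx : x ∈ s
    · exact Or.inl (measure_mono_null (singleton_subset_iff.2 hx) h1)
    · exact Or.inr (measure_mono_null (singleton_subset_iff.2 hx) h2)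
  unfold varK
  have e : ∀ x, ENNReal.ofReal (K ((σ + κ).real {x})) =
      ENNReal.ofReal (K (σ.real {x})) + ENNReal.ofReal (K (κ.real {x})) := by
    intro x
    rw [measureReal_add_apply]
    rcases h0 x with h | h <;> simp [measureReal_def, h, hK1.2.2]
  simp_rw [e]
  rw [ENNReal.tsum_add, Measure.add_apply, nonatoms_add_eq, measure_nonatoms_diff _
    (countable_atoms κ), ← nonatoms_add_eq, add_comm σ κ, nonatoms_add_eq, measure_nonatoms_diff _
    (countable_atoms σ)]
  ring

include hK2

theorem varK_add_le : varK K (σ + κ) ≤ varK K σ + varK K κ := by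
  unfold varK
  have e : ∀ x, ENNReal.ofReal (K ((σ + κ).real {x})) ≤
      ENNReal.ofReal (K (σ.real {x})) + ENNReal.ofReal (K (κ.real {x})) := by
    intro x
    rw [measureReal_add_apply, ← ENNReal.ofReal_add (hK1.nonneg measureReal_nonneg)
      (hK1.nonneg measureReal_nonneg)]
    exact ENNReal.ofReal_le_ofReal (hK2.add_le measureReal_nonneg measureReal_nonneg)
  have e' := ENNReal.tsum_le_tsum e
  rw [ENNReal.tsum_add] at e'
  rw [Measure.add_apply, nonatoms_add_eq, measure_nonatoms_diff _
    (countable_atoms κ), ← nonatoms_add_eq, add_comm σ κ, nonatoms_add_eq, measure_nonatoms_diff _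
    (countable_atoms σ), add_comm κ σ]
  refine (add_le_add le_rfl e').trans (le_of_eq ?_)
  ring

include hK3

theorem varK_ne_top : varK K σ ≠ ⊤ := by
  refine ne_top_of_le_ne_top (measure_ne_top σ univ) ?_
  rw [← measure_nonatoms_add_tsum σ]
  unfold varK
  gcongr with x
  exact (ENNReal.ofReal_le_ofReal (le_self_of_condK hK1 hK2 hK3 measureReal_nonneg)).trans
    ENNReal.ofReal_toReal_le

/-- The gain from collapsing all of `σ` into one atom. With atomic mass `A` and diffuse mass `D`,
three mergers contribute: the atoms among themselves (`le_sum`, in the limit), the diffuse part into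
an atom (`le_sub`), and the two results, with gain `C * A * D`. Their sum is the defect, because `(A
+ D)² = A² + D² + 2AD`. -/
theorem le_toReal_varK {M C : ℝ} (hC : IsMergeConst K M C) (hM : σ.real univ ≤ M) :
    K (σ.real univ) + C / 2 * (σ.real univ ^ 2 - ∑' x, σ.real {x} ^ 2) ≤ (varK K σ).toReal := by
  set D := σ.real {x | σ {x} = 0} with hD
  have hsum := hasSum_real_singleton σ
  set A := σ.real univ - D with hA
  have hA0 : 0 ≤ A := hsum.nonneg fun x => measureReal_nonneg
  have hD0 : 0 ≤ D := measureReal_nonneg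
  have hAP : A + D = σ.real univ := by rw [hA]; ring
  have hp0 : ∀ x, 0 ≤ σ.real {x} := fun x => measureReal_nonneg
  have hsumK : Summable fun x => K (σ.real {x}) :=
    Summable.of_nonneg_of_le (fun x => hK1.nonneg (hp0 x))
      (fun x => le_self_of_condK hK1 hK2 hK3 (hp0 x)) hsum.summable
  have hQ := (summable_real_singleton_sq σ).hasSum
  have hval : (varK K σ).toReal = D + ∑' x, K (σ.real {x}) := by
    unfold varK
    rw [← ENNReal.ofReal_tsum_of_nonneg (fun x => hK1.nonneg (hp0 x)) hsumK,
      ENNReal.toReal_add (measure_ne_top _ _) ENNReal.ofReal_ne_top,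
      ENNReal.toReal_ofReal (tsum_nonneg fun x => hK1.nonneg (hp0 x)), hD, measureReal_def]
  have h1 : K A + C / 2 * (A ^ 2 - ∑' x, σ.real {x} ^ 2) ≤ ∑' x, K (σ.real {x}) := by
    have hKA : Tendsto (fun s : Finset ℝ => K (∑ x ∈ s, σ.real {x})) atTop (𝓝 (K A)) :=
      (hK1.1 A hA0).tendsto.comp (tendsto_nhdsWithin_iff.2
        ⟨hsum, Eventually.of_forall fun s => Finset.sum_nonneg fun x _ => hp0 x⟩)
    have hlim : Tendsto (fun s : Finset ℝ => K (∑ x ∈ s, σ.real {x}) + C / 2 *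
        ((∑ x ∈ s, σ.real {x}) ^ 2 - ∑ x ∈ s, σ.real {x} ^ 2)) atTop
        (𝓝 (K A + C / 2 * (A ^ 2 - ∑' x, σ.real {x} ^ 2))) :=
      hKA.add ((Tendsto.sub (Tendsto.pow hsum 2) hQ).const_mul _)
    refine le_of_tendsto_of_tendsto' hlim hsumK.hasSum fun s => ?_
    refine hC.le_sum hK1 s hp0 ?_
    exact (sum_le_hasSum s (fun x _ => hp0 x) hsum).trans (by linarith)
  have h2 := hC.le_sub hK1 hK3 hD0 (by linarith)
  have h3 := hC.2 A D hA0 hD0 (by linarith)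
  rw [hAP] at h3
  rw [hval, ← hAP]
  rw [hAP]
  have h4 : σ.real univ ^ 2 = A ^ 2 + D ^ 2 + 2 * (A * D) := by rw [← hAP]; ring
  rw [h4]
  nlinarith

omit hK2 hK3 in
theorem varK_smul_dirac {r : ℝ} (hr : 0 ≤ r) (p : ℝ) :
    varK K (ENNReal.ofReal r • Measure.dirac p) ≤ ENNReal.ofReal (K r) := by
  unfold varK
  have e1 : (ENNReal.ofReal r • Measure.dirac p)
      {x | (ENNReal.ofReal r • Measure.dirac p) {x} = 0} = 0 := by
    by_cases h : r = 0
    · simp [h]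
    · have hr' : 0 < r := lt_of_le_of_ne hr (Ne.symm h)
      have hp : p ∉ {x | (ENNReal.ofReal r • Measure.dirac p) {x} = 0} := by simp [hr']
      have : IsFiniteMeasure (ENNReal.ofReal r • Measure.dirac p) :=
        Measure.smul_finite _ ENNReal.ofReal_ne_top
      have hm := measurableSet_nonatoms (ENNReal.ofReal r • Measure.dirac p)
      rw [Measure.smul_apply, Measure.dirac_apply' _ hm, indicator_of_notMem hp, smul_zero]
  have e2 : ∀ x, ENNReal.ofReal (K ((ENNReal.ofReal r • Measure.dirac p).real {x})) =
      if x = p then ENNReal.ofReal (K r) else 0 := by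
    intro x
    split_ifs with h
    · subst h; simp [measureReal_def, hr]
    · simp [measureReal_def, Ne.symm h, hK1.2.2]
  simp_rw [e2]
  rw [tsum_ite_eq, e1, zero_add]

end VarK

/-! ### The functional `TVK` in terms of the derivative measure. -/

/-- By mutual singularity of the Jordan parts, at most one of them charges a given point, so the
jump height there is the mass of the total variation. -/
theorem TVK_eq_varK {K : ℝ → ℝ} (hK1 : CondK1 K) {a b : ℝ} (hab : a < b) {u : ℝ → ℝ}
    (hu : MemBV a b u) : TVK K a b u = varK K (distribDeriv a b u).totalVariation ∧
      jumpSet a b u = {x | (distribDeriv a b u).totalVariation {x} ≠ 0} := by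
  have h := isDistribDeriv_distribDeriv hu
  obtain ⟨c, hc⟩ := h.exists_ae_eq_cumul hab hu.1
  set μ := distribDeriv a b u
  set σ := μ.toJordanDecomposition.posPart
  set κ := μ.toJordanDecomposition.negPart
  have hτ : μ.totalVariation = σ + κ := rfl
  have hnull : (σ + κ) (Ioo a b)ᶜ = 0 := h.1
  have hout : ∀ x, x ∉ Ioo a b → (σ + κ) {x} = 0 := fun x hx =>
    measure_mono_null (singleton_subset_iff.2 hx) hnull
  have h0 : ∀ x, σ.real {x} = 0 ∨ κ.real {x} = 0 := by
    obtain ⟨s, -, h1, h2⟩ := μ.toJordanDecomposition.mutuallySingular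
    intro x
    by_cases hx : x ∈ s
    · exact Or.inl ((measureReal_eq_zero_iff).2 (measure_mono_null (singleton_subset_iff.2 hx) h1))
    · exact Or.inr ((measureReal_eq_zero_iff).2 (measure_mono_null (singleton_subset_iff.2 hx) h2))
  have habs : ∀ x, |σ.real {x} - κ.real {x}| = (σ + κ).real {x} := by
    intro x
    rw [measureReal_add_apply]
    rcases h0 x with h | h <;> simp [h]
  have hJ : jumpSet a b u = {x | (σ + κ) {x} ≠ 0} := by
    rw [jumpSet_eq hc]
    ext x
    simp only [mem_ofPred_eq]
    rw [← sub_ne_zero, ← abs_ne_zero, habs, measureReal_ne_zero_iff]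
    refine ⟨fun h => h.2, fun h => ⟨?_, h⟩⟩
    by_contra hx
    exact h (hout x hx)
  refine ⟨?_, hJ⟩
  unfold TVK varK
  rw [hτ]
  congr 1
  · rw [hJ]
    rw [measure_eq_measure_inter_Ioo hnull {x | (σ + κ) {x} = 0}]
    congr 1
    ext x
    simp only [Set.mem_sdiff, mem_inter_iff, mem_ofPred_eq, not_not]
    exact and_comm
  · rw [← tsum_subtype_eq_of_support_subset (s := jumpSet a b u)
      (f := fun x => ENNReal.ofReal (K ((σ + κ).real {x})))]
    · refine tsum_congr fun x => ?_
      rw [rightTrace_sub_leftTrace hc x.2.1, habs]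
    · intro x hx
      rw [hJ]
      intro h
      apply hx
      simp [measureReal_def, h, hK1.2.2]

theorem TVK_le_varK {K : ℝ → ℝ} (hK1 : CondK1 K) {a b c : ℝ} (hab : a < b) {u : ℝ → ℝ}
    {σ κ : Measure ℝ} [IsFiniteMeasure σ] [IsFiniteMeasure κ] (h1 : σ (Ioo a b)ᶜ = 0)
    (h2 : κ (Ioo a b)ᶜ = 0) (hu : u =ᵐ[volume.restrict (Ioo a b)] cumul c σ κ) :
    TVK K a b u ≤ varK K (σ + κ) := by
  rw [(TVK_eq_varK hK1 hab (memBV_of_ae_eq_cumul h1 h2 hu)).1,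
    distribDeriv_eq_of_ae_eq_cumul hab h1 h2 hu]
  exact varK_mono hK1 _ _ (totalVariation_toSignedMeasure_sub_le σ κ)

/-! ### Averaging over the position of a single jump. -/

section SingleJump

variable (σ : Measure ℝ) [IsFiniteMeasure σ]

/-- Atoms up to `x` and atoms beyond `x` are treated separately; on each side the sum of squares is
at most the square of the mass. -/
theorem tsum_real_singleton_sq_le (x : ℝ) :
    ∑' y, σ.real {y} ^ 2 ≤ σ.real (Iic x) ^ 2 + (σ.real univ - σ.real (Iic x)) ^ 2 := by
  have hcompl : σ.real univ - σ.real (Iic x) = σ.real (Ioi x) := by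
    rw [← measureReal_add_measureReal_compl (measurableSet_Iic (a := x)), compl_Iic]; ring
  have key : ∀ (F : Finset ℝ) (A : Set ℝ), (∀ y ∈ F, y ∈ A) →
      ∑ y ∈ F, σ.real {y} ^ 2 ≤ σ.real A ^ 2 := by
    intro F A hFA
    have h1 : ∑ y ∈ F, σ.real {y} ≤ σ.real A := by
      rw [sum_measureReal_singleton]
      exact measureReal_mono (fun y hy => hFA y hy)
    calc ∑ y ∈ F, σ.real {y} ^ 2 ≤ ∑ y ∈ F, σ.real A * σ.real {y} := by
          refine Finset.sum_le_sum fun y hy => ?_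
          rw [sq]
          exact mul_le_mul_of_nonneg_right
            (measureReal_mono (singleton_subset_iff.2 (hFA y hy))) measureReal_nonneg
      _ = σ.real A * ∑ y ∈ F, σ.real {y} := (Finset.mul_sum _ _ _).symm
      _ ≤ σ.real A * σ.real A := mul_le_mul_of_nonneg_left h1 measureReal_nonneg
      _ = _ := (sq _).symm
  rw [hcompl]
  refine Real.tsum_le_of_sum_le (fun y => sq_nonneg _) fun F => ?_
  rw [← Finset.sum_filter_add_sum_filter_not F (fun y => y ≤ x)]
  exact add_le_add (key _ _ fun y hy => (Finset.mem_filter.1 hy).2)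
    (key _ _ fun y hy => not_le.1 (Finset.mem_filter.1 hy).2)

/-- Pointwise comparison for a jump of height `d = P - N` placed at random according to a
distribution function `m / P`: the variance is controlled by `R`, the shift of the mean by `N`. -/
theorem random_jump_pointwise {P N m n G M R : ℝ} (hP : 0 < P) (hm0 : 0 ≤ m) (hmP : m ≤ P)
    (hn0 : 0 ≤ n) (hnN : n ≤ N) (hNP : N ≤ P) (hR : m * (P - m) ≤ R) (h1 : |m - n - G| ≤ M)
    (h2 : |G| ≤ M) (h3 : |P - N - G| ≤ M) :
    P * G ^ 2 + ((P - N) ^ 2 - 2 * (P - N) * G) * m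
      ≤ P * (m - n - G) ^ 2 + P * (2 * M * N + R) := by
  have hM : 0 ≤ M := (abs_nonneg _).trans h2
  have hN : 0 ≤ N := hn0.trans hnN
  set d := P - N with hd
  set W := m - n with hW
  -- Second moment equals squared bias plus variance, for a jump that has occurred with probability
  -- `m / P`; everything is scaled by `P²`.
  have e1 : P * (P * G ^ 2 + (d ^ 2 - 2 * d * G) * m)
      = (d * m - P * G) ^ 2 + d ^ 2 * (m * (P - m)) := by ring
  have b1 : |d * m - P * W| ≤ P * N := by
    have : d * m - P * W = P * n - N * m := by rw [hd, hW]; ring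
    rw [this, abs_le]
    have i1 := mul_le_mul_of_nonneg_left hnN hP.le
    have i2 := mul_le_mul_of_nonneg_left hmP hN
    have i3 := mul_nonneg hP.le hn0
    have i4 := mul_nonneg hN hm0
    constructor <;> nlinarith
  have b2 : |d * m - P * G| ≤ P * M := by
    have : d * m - P * G = m * (d - G) + (P - m) * (-G) := by ring
    rw [this]
    refine (abs_add_le _ _).trans ?_
    rw [abs_mul, abs_mul, abs_neg, abs_of_nonneg hm0, abs_of_nonneg (sub_nonneg.2 hmP)]
    have i1 := mul_le_mul_of_nonneg_left h3 hm0
    have i2 := mul_le_mul_of_nonneg_left h2 (sub_nonneg.2 hmP)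
    nlinarith
  have b3 : |P * W - P * G| ≤ P * M := by
    rw [← mul_sub, abs_mul, abs_of_pos hP]
    exact mul_le_mul_of_nonneg_left h1 hP.le
  have e2 : (d * m - P * G) ^ 2 - (P * W - P * G) ^ 2
      = (d * m - P * W) * ((d * m - P * G) + (P * W - P * G)) := by ring
  have b4 : (d * m - P * W) * ((d * m - P * G) + (P * W - P * G)) ≤ (P * N) * (P * M + P * M) := by
    refine (le_abs_self _).trans ?_
    rw [abs_mul]
    exact mul_le_mul b1 ((abs_add_le _ _).trans (add_le_add b2 b3)) (abs_nonneg _) (by positivity)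
  have b5 : d ^ 2 * (m * (P - m)) ≤ P ^ 2 * R := by
    have : d ^ 2 ≤ P ^ 2 := by
      have : 0 ≤ d := sub_nonneg.2 hNP
      have : d ≤ P := by rw [hd]; linarith
      gcongr
    have i0 : 0 ≤ m * (P - m) := mul_nonneg hm0 (sub_nonneg.2 hmP)
    exact mul_le_mul this hR i0 (sq_nonneg _)
  have e3 : P * (P * (W - G) ^ 2 + P * (2 * M * N + R))
      = (P * W - P * G) ^ 2 + (P * N) * (P * M + P * M) + P ^ 2 * R := by ring
  refine le_of_mul_le_mul_left ?_ hP
  rw [e1, e3]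
  linarith

/-- If replacing `cumul 0 σ κ` on `(s, t)` by a single jump never pays off, then `κ = 0` and `σ` is
a single atom. -/
theorem single_atom_of_jump_le (κ : Measure ℝ) [IsFiniteMeasure κ] {s t : ℝ} (hst : s < t)
    (hσ : σ (Ioo s t)ᶜ = 0) {G : ℝ → ℝ}
    (hG : AEStronglyMeasurable G (volume.restrict (Ioo s t))) {M C c lam S : ℝ} {K : ℝ → ℝ}
    (hlam : 0 < lam) (hd : κ.real univ ≤ σ.real univ)
    (hK : K (σ.real univ - κ.real univ) ≤ K (σ.real univ))
    (h1 : ∀ x ∈ Ioo s t, |cumul 0 σ κ x - G x| ≤ M) (h2 : ∀ x ∈ Ioo s t, |G x| ≤ M)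
    (h3 : ∀ x ∈ Ioo s t, |σ.real univ - κ.real univ - G x| ≤ M)
    (hS : K (σ.real univ) + C / 2 * (σ.real univ ^ 2 - ∑' x, σ.real {x} ^ 2) + c * κ.real univ ≤ S)
    (hmin : ∀ p ∈ Ioo s t, S + lam / 2 * ∫ x in Ioo s t, (cumul 0 σ κ x - G x) ^ 2 ≤
      K (σ.real univ - κ.real univ) +
        lam / 2 * ∫ x in Ioo s t, ((if p ≤ x then σ.real univ - κ.real univ else 0) - G x) ^ 2)
    (hl1 : lam * (t - s) < 2 * C) (hl2 : lam * (t - s) * M < c) :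
    κ.real univ = 0 ∧ σ.real univ ^ 2 = ∑' x, σ.real {x} ^ 2 := by
  have hN0 : 0 ≤ κ.real univ := measureReal_nonneg
  have hP0 : 0 ≤ σ.real univ := measureReal_nonneg
  have hmono : ∀ (σ : Measure ℝ) [IsFiniteMeasure σ] (x : ℝ), σ.real (Iic x) ≤ σ.real univ :=
    fun σ _ x => measureReal_mono (subset_univ _)
  rcases hP0.eq_or_lt with hP | hP
  · refine ⟨le_antisymm (hP ▸ hd) hN0, ?_⟩
    have : ∀ x, σ.real {x} = 0 := fun x =>
      le_antisymm (hP ▸ real_singleton_le σ x) measureReal_nonneg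
    simp [this, ← hP]
  set P := σ.real univ
  set N := κ.real univ
  set Q := ∑' x, σ.real {x} ^ 2
  set d := P - N with hdd
  -- The variance of the random jump at every `x` is controlled by the defect `P² - Q`, the same
  -- quantity that measures the gain in variation.
  have hR : ∀ x, σ.real (Iic x) * (P - σ.real (Iic x)) ≤ (P ^ 2 - Q) / 2 := by
    intro x
    have := tsum_real_singleton_sq_le σ x
    nlinarith
  have hQP : 0 ≤ P ^ 2 - Q := by
    have i1 := hR s
    have i2 := mul_nonneg (measureReal_nonneg (μ := σ) (s := Iic s)) (sub_nonneg.2 (hmono σ s))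
    linarith
  set ρ := volume.restrict (Ioo s t) with hρ
  have hbdd : ∀ {f : ℝ → ℝ} {B : ℝ}, AEStronglyMeasurable f ρ → (∀ x ∈ Ioo s t, |f x| ≤ B) →
      Integrable f ρ := fun hf hB =>
    Integrable.of_bound hf _ ((ae_restrict_iff' measurableSet_Ioo).2 (Eventually.of_forall hB))
  have hGi : Integrable G ρ := hbdd hG h2
  have hG2 : Integrable (fun x => G x ^ 2) ρ := by
    refine hbdd (B := M ^ 2) (hG.pow 2) fun x hx => ?_
    rw [abs_pow]
    exact pow_le_pow_left₀ (abs_nonneg _) (h2 x hx) 2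
  have hW2 : Integrable (fun x => (cumul 0 σ κ x - G x) ^ 2) ρ := by
    refine hbdd (B := M ^ 2) (((measurable_cumul 0 σ κ).aestronglyMeasurable.sub hG).pow 2)
      fun x hx => ?_
    rw [abs_pow]
    exact pow_le_pow_left₀ (abs_nonneg _) (h1 x hx) 2
  have hf : Integrable (fun x => d ^ 2 - 2 * d * G x) ρ :=
    (integrable_const _).sub (hGi.const_mul _)
  have hfm : Integrable (fun x => (d ^ 2 - 2 * d * G x) * σ.real (Iic x)) ρ :=
    hf.mul_bdd (c := P) (measurable_real_Iic σ).aestronglyMeasurable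
      (Eventually.of_forall fun x => by
        rw [Real.norm_of_nonneg measureReal_nonneg]; exact hmono σ x)
  -- Expanding the square leaves the dependence on `p` in a tail integral, ready for
  -- `integral_mul_real_Iic`.
  have hexp : ∀ p, ∫ x, ((if p ≤ x then d else 0) - G x) ^ 2 ∂ρ
      = (∫ x, G x ^ 2 ∂ρ) + ∫ x in Ici p, (d ^ 2 - 2 * d * G x) ∂ρ := by
    intro p
    rw [← integral_indicator measurableSet_Ici, ← integral_add hG2
      (hf.indicator measurableSet_Ici)]
    refine integral_congr_ae (Eventually.of_forall fun x => ?_)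
    by_cases hx : p ≤ x
    · simp only [hx, if_true, indicator_of_mem (show x ∈ Ici p from hx)]; ring
    · simp only [hx, if_false, indicator_of_notMem (show x ∉ Ici p from hx)]; ring
  have hsupp : ∀ᵐ p ∂σ, p ∈ Ioo s t := by
    rw [ae_iff]; exact hσ
  have hint : Integrable (fun p => ∫ x in Ici p, (d ^ 2 - 2 * d * G x) ∂ρ) σ :=
    integrable_setIntegral_Ici ρ σ hf
  -- Minimality is integrated over `p` against `σ`, whose total mass is `P`.
  have hav : P * (S + lam / 2 * ∫ x, (cumul 0 σ κ x - G x) ^ 2 ∂ρ) ≤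
      P * (K d + lam / 2 * ∫ x, G x ^ 2 ∂ρ)
        + lam / 2 * ∫ x, (d ^ 2 - 2 * d * G x) * σ.real (Iic x) ∂ρ := by
    have := integral_mono_ae (μ := σ)
      (f := fun _ => S + lam / 2 * ∫ x, (cumul 0 σ κ x - G x) ^ 2 ∂ρ)
      (g := fun p => (K d + lam / 2 * ∫ x, G x ^ 2 ∂ρ)
        + lam / 2 * ∫ x in Ici p, (d ^ 2 - 2 * d * G x) ∂ρ)
      (integrable_const _) ((integrable_const _).add (hint.const_mul _)) (by
        filter_upwards [hsupp] with p hp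
        have := hmin p hp
        rw [hexp] at this
        linarith)
    rw [integral_const, integral_add (integrable_const _) (hint.const_mul _), integral_const,
      integral_const_mul, ← integral_mul_real_Iic ρ σ hf] at this
    exact this
  have hpt : ∫ x, (P * G x ^ 2 + (d ^ 2 - 2 * d * G x) * σ.real (Iic x)) ∂ρ ≤
      ∫ x, (P * (cumul 0 σ κ x - G x) ^ 2 + P * (2 * M * N + (P ^ 2 - Q) / 2)) ∂ρ := by
    refine integral_mono_ae ((hG2.const_mul P).add hfm)
      ((hW2.const_mul P).add (integrable_const _)) ?_
    filter_upwards [ae_restrict_mem measurableSet_Ioo] with x hx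
    have e : cumul 0 σ κ x = σ.real (Iic x) - κ.real (Iic x) := by simp [cumul]
    have hb1 := h1 x hx
    rw [e] at hb1
    simp only [e]
    exact random_jump_pointwise hP measureReal_nonneg (hmono σ x) measureReal_nonneg (hmono κ x)
      hd (hR x) hb1 (h2 x hx) (h3 x hx)
  rw [integral_add (hG2.const_mul P) hfm, integral_add (hW2.const_mul P) (integrable_const _),
    integral_const_mul, integral_const_mul, integral_const] at hpt
  have hvol : ρ.real univ = t - s := by
    rw [hρ, measureReal_restrict_apply_univ, Real.volume_real_Ioo_of_le hst.le]
  rw [hvol, smul_eq_mul] at hpt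
  have hfin : P * S ≤ P * (K d + lam * (t - s) * M * N + lam * (t - s) / 4 * (P ^ 2 - Q)) := by
    have := mul_le_mul_of_nonneg_left hpt (by positivity : (0 : ℝ) ≤ lam / 2)
    nlinarith
  have hfin' := le_of_mul_le_mul_left hfin hP
  -- Both coefficients, gain minus cost, are positive by the smallness of `t - s`; since the sum is
  -- nonpositive, `P² - Q` and `N` vanish.
  have z1 : 0 ≤ (C / 2 - lam * (t - s) / 4) * (P ^ 2 - Q) :=
    mul_nonneg (by linarith) hQP
  have z2 : 0 ≤ (c - lam * (t - s) * M) * N := mul_nonneg (by linarith) hN0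
  have z3 : (C / 2 - lam * (t - s) / 4) * (P ^ 2 - Q) + (c - lam * (t - s) * M) * N ≤ 0 := by
    linarith
  constructor
  · have : (c - lam * (t - s) * M) * N = 0 := by linarith
    exact (mul_eq_zero.1 this).resolve_left (by linarith)
  · have : (C / 2 - lam * (t - s) / 4) * (P ^ 2 - Q) = 0 := by linarith
    have := (mul_eq_zero.1 this).resolve_left (by linarith)
    linarith

/-- The terms `σ{x} (σ(ℝ) - σ{x})` are nonnegative with nonpositive sum, so every atom carries all
of the mass or none. -/
theorem exists_singleton_of_sq_eq (h : σ.real univ ^ 2 = ∑' x, σ.real {x} ^ 2) :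
    ∃ x₀, σ {x₀}ᶜ = 0 := by
  have hsum := hasSum_real_singleton σ
  have hsq := (summable_real_singleton_sq σ).hasSum
  have hdiff := (hsum.mul_left (σ.real univ)).sub hsq
  have hnn : ∀ x, 0 ≤ σ.real univ * σ.real {x} - σ.real {x} ^ 2 := by
    intro x
    have i1 := real_singleton_le σ x
    have i2 : 0 ≤ σ.real {x} := measureReal_nonneg
    nlinarith
  have hle : σ.real univ * (σ.real univ - σ.real {x | σ {x} = 0}) - ∑' x, σ.real {x} ^ 2 ≤ 0 := by
    rw [← h]
    have : 0 ≤ σ.real univ * σ.real {x | σ {x} = 0} := by positivity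
    linarith
  have hz : ∀ x, σ.real univ * σ.real {x} - σ.real {x} ^ 2 = 0 := by
    have h0 := le_antisymm hle (hdiff.nonneg hnn)
    rw [h0] at hdiff
    exact fun x => congrFun ((hasSum_zero_iff_of_nonneg hnn).1 hdiff) x
  by_cases hall : ∀ x, σ.real {x} = 0
  · refine ⟨0, ?_⟩
    have : σ.real univ = 0 := by
      have : σ.real univ ^ 2 = 0 := by rw [h]; simp [hall]
      exact pow_eq_zero_iff two_ne_zero |>.1 this
    exact measure_mono_null (subset_univ _) ((measureReal_eq_zero_iff).1 this)
  · push Not at hall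
    obtain ⟨x, hx⟩ := hall
    refine ⟨x, ?_⟩
    have h1 : σ.real univ = σ.real {x} := by
      have : (σ.real univ - σ.real {x}) * σ.real {x} = 0 := by have := hz x; linarith
      have := (mul_eq_zero.1 this).resolve_right hx
      linarith
    have h2 := measureReal_add_measureReal_compl (μ := σ) (measurableSet_singleton x)
    rw [← measureReal_eq_zero_iff]
    linarith

end SingleJump

/-! ### Minimality as a statement about pairs of measures. -/

/-- The finite measures `σ`, `κ` are the positive and negative part of the derivative of
`cumul c σ κ` on `(a, b)`, and this function is optimal among all functions of this form. -/
structure IsMinimalPair (K : ℝ → ℝ) (lam : ℝ) (g : ℝ → ℝ) (a b c : ℝ) (σ κ : Measure ℝ) :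
    Prop where
  pos_null : σ (Ioo a b)ᶜ = 0
  neg_null : κ (Ioo a b)ᶜ = 0
  mutuallySingular : σ ⟂ₘ κ
  le : ∀ (c' : ℝ) (σ' κ' : Measure ℝ) [IsFiniteMeasure σ'] [IsFiniteMeasure κ'],
    σ' (Ioo a b)ᶜ = 0 → κ' (Ioo a b)ᶜ = 0 →
      (varK K (σ + κ)).toReal + lam / 2 * ∫ x in Ioo a b, (cumul c σ κ x - g x) ^ 2 ≤
        (varK K (σ' + κ')).toReal + lam / 2 * ∫ x in Ioo a b, (cumul c' σ' κ' x - g x) ^ 2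

theorem aestronglyMeasurable_of_continuousOn_Icc {g : ℝ → ℝ} {a b : ℝ}
    (hg : ContinuousOn g (Icc a b)) : AEStronglyMeasurable g (volume.restrict (Ioo a b)) :=
  (hg.mono Ioo_subset_Icc_self).aestronglyMeasurable measurableSet_Ioo

theorem integrableOn_sq_cumul_sub {g : ℝ → ℝ} {a b : ℝ} (hg : ContinuousOn g (Icc a b)) (c : ℝ)
    (σ κ : Measure ℝ) [IsFiniteMeasure σ] [IsFiniteMeasure κ] :
    IntegrableOn (fun x => (cumul c σ κ x - g x) ^ 2) (Ioo a b) := by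
  obtain ⟨B, hB⟩ := isCompact_Icc.exists_bound_of_continuousOn hg
  refine Integrable.of_bound (((measurable_cumul c σ κ).aestronglyMeasurable.sub
    (aestronglyMeasurable_of_continuousOn_Icc hg)).pow 2)
    ((|c| + (σ.real univ + κ.real univ) + B) ^ 2)
    ((ae_restrict_iff' measurableSet_Ioo).2 (Eventually.of_forall fun x hx => ?_))
  rw [norm_pow]
  gcongr
  exact (norm_sub_le _ _).trans (add_le_add (abs_cumul_le c σ κ x)
    (hB x (Ioo_subset_Icc_self hx)))

theorem lintegral_sq_sub_eq {g u : ℝ → ℝ} {a b : ℝ} (hg : ContinuousOn g (Icc a b)) {c : ℝ}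
    {σ κ : Measure ℝ} [IsFiniteMeasure σ] [IsFiniteMeasure κ]
    (hu : u =ᵐ[volume.restrict (Ioo a b)] cumul c σ κ) :
    ∫⁻ x in Ioo a b, ENNReal.ofReal (|u x - g x| ^ 2) =
      ENNReal.ofReal (∫ x in Ioo a b, (cumul c σ κ x - g x) ^ 2) := by
  rw [ofReal_integral_eq_lintegral_ofReal (integrableOn_sq_cumul_sub hg c σ κ)
    (Eventually.of_forall fun x => sq_nonneg _)]
  refine lintegral_congr_ae (hu.mono fun x hx => ?_)
  simp only [hx, sq_abs]

theorem IsMinimizer.exists_isMinimalPair {K : ℝ → ℝ} (hK1 : CondK1 K) (hK2 : CondK2 K)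
    (hK3 : CondK3 K) {a b : ℝ} (hab : a < b) {lam : ℝ} (hlam : 0 < lam) {g : ℝ → ℝ}
    (hg : ContinuousOn g (Icc a b)) {U : ℝ → ℝ} (hU : IsMinimizer K lam g a b U) :
    ∃ (c : ℝ) (σ κ : Measure ℝ) (_ : IsFiniteMeasure σ) (_ : IsFiniteMeasure κ),
      cumul c σ κ =ᵐ[volume.restrict (Ioo a b)] U ∧ jumpSet a b U = {x | (σ + κ) {x} ≠ 0} ∧
        IsMinimalPair K lam g a b c σ κ := by
  have h := isDistribDeriv_distribDeriv hU.1
  obtain ⟨c, hc⟩ := h.exists_ae_eq_cumul hab hU.1.1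
  obtain ⟨hTV, hJ⟩ := TVK_eq_varK hK1 hab hU.1
  set μ := distribDeriv a b U
  set σ := μ.toJordanDecomposition.posPart with hσ
  set κ := μ.toJordanDecomposition.negPart with hκ
  have hτ : μ.totalVariation = σ + κ := rfl
  have hnull : (σ + κ) (Ioo a b)ᶜ = 0 := h.1
  rw [Measure.add_apply, add_eq_zero] at hnull
  rw [hτ] at hTV hJ
  refine ⟨c, σ, κ, inferInstance, inferInstance, hc.symm, hJ, hnull.1, hnull.2,
    μ.toJordanDecomposition.mutuallySingular, ?_⟩
  intro c' σ' κ' _ _ h1 h2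
  have hle := hU.2 (cumul c' σ' κ') (memBV_of_ae_eq_cumul h1 h2 (EventuallyEq.refl _ _))
  have hle' := hle.trans (add_le_add (TVK_le_varK hK1 hab h1 h2 (EventuallyEq.refl _ _)) le_rfl)
  rw [TVKg, hTV, lintegral_sq_sub_eq hg hc,
    lintegral_sq_sub_eq hg (EventuallyEq.refl _ (cumul c' σ' κ')),
    ← ENNReal.ofReal_toReal (varK_ne_top hK1 hK2 hK3 (σ + κ)),
    ← ENNReal.ofReal_toReal (varK_ne_top hK1 hK2 hK3 (σ' + κ')),
    ← ENNReal.ofReal_mul (by positivity), ← ENNReal.ofReal_mul (by positivity),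
    ← ENNReal.ofReal_add ENNReal.toReal_nonneg
      (mul_nonneg (by positivity) (integral_nonneg fun x => sq_nonneg _)),
    ← ENNReal.ofReal_add ENNReal.toReal_nonneg
      (mul_nonneg (by positivity) (integral_nonneg fun x => sq_nonneg _))] at hle'
  exact (ENNReal.ofReal_le_ofReal_iff (add_nonneg ENNReal.toReal_nonneg
      (mul_nonneg (by positivity) (integral_nonneg fun x => sq_nonneg _)))).1 hle'

/-! ### Distribution functions of restricted measures. -/

section Splice

variable (σ : Measure ℝ) [IsFiniteMeasure σ] {s t x : ℝ}

theorem real_Iic_eq_restrict_add : σ.real (Iic x) =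
    (σ.restrict (Ioo s t)ᶜ).real (Iic x) + (σ.restrict (Ioo s t)).real (Iic x) := by
  rw [measureReal_restrict_apply measurableSet_Iic, measureReal_restrict_apply measurableSet_Iic,
    ← measureReal_inter_add_sdiff (s := Iic x) (measurableSet_Ioo (a := s) (b := t)), add_comm]
  rfl

omit [IsFiniteMeasure σ] in
theorem restrict_Ioo_real_Iic_of_le (hx : x ≤ s) :
    (σ.restrict (Ioo s t)).real (Iic x) = 0 := by
  rw [measureReal_restrict_apply measurableSet_Iic]
  have : Iic x ∩ Ioo s t = ∅ := by
    ext y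
    simp only [mem_inter_iff, mem_Iic, mem_Ioo, mem_empty_iff_false, iff_false]
    rintro ⟨h1, h2, -⟩
    linarith
  rw [this, measureReal_empty]

omit [IsFiniteMeasure σ] in
theorem restrict_Ioo_real_Iic_of_ge (hx : t ≤ x) :
    (σ.restrict (Ioo s t)).real (Iic x) = σ.real (Ioo s t) := by
  rw [measureReal_restrict_apply measurableSet_Iic]
  congr 1
  exact inter_eq_right.2 fun y hy => hy.2.le.trans hx

omit [IsFiniteMeasure σ] in
theorem restrict_compl_Ioo_real_Iic (hx : x ∈ Ioo s t) :
    (σ.restrict (Ioo s t)ᶜ).real (Iic x) = σ.real (Iic s) := by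
  rw [measureReal_restrict_apply measurableSet_Iic]
  congr 1
  ext y
  simp only [mem_inter_iff, mem_Iic, mem_compl_iff, mem_Ioo, not_and, not_lt]
  constructor
  · rintro ⟨h1, h2⟩
    by_contra h
    have := h2 (not_le.1 h)
    linarith [hx.2]
  · intro h
    exact ⟨h.trans hx.1.le, fun h' => absurd h (not_le.2 h')⟩

theorem smul_dirac_real_Iic {r : ℝ} (hr : 0 ≤ r) (p : ℝ) :
    (ENNReal.ofReal r • Measure.dirac p).real (Iic x) = if p ≤ x then r else 0 := by
  rw [measureReal_ennreal_smul_apply, ENNReal.toReal_ofReal hr, measureReal_def,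
    Measure.dirac_apply' _ measurableSet_Iic]
  by_cases h : p ≤ x <;> simp [h]

end Splice

/-! ### Comparison on a short interval. -/

section Merge

variable {K : ℝ → ℝ} {lam : ℝ} {g : ℝ → ℝ} {a b c : ℝ} {σ κ : Measure ℝ} [IsFiniteMeasure σ]
  [IsFiniteMeasure κ]

/-- Comparison with the function whose derivative on `(s, t)` is moved into one point `p`. -/
theorem IsMinimalPair.le_single_jump (hK1 : CondK1 K) (hK2 : CondK2 K) (hK3 : CondK3 K)
    (hg : ContinuousOn g (Icc a b)) (h : IsMinimalPair K lam g a b c σ κ) {s t : ℝ}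
    (has : a ≤ s) (htb : t ≤ b) {p : ℝ} (hp : p ∈ Ioo s t) :
    (varK K (σ.restrict (Ioo s t) + κ.restrict (Ioo s t))).toReal +
        lam / 2 * ∫ x in Ioo s t,
          (cumul 0 (σ.restrict (Ioo s t)) (κ.restrict (Ioo s t)) x - (g x - cumul c σ κ s)) ^ 2 ≤
      K |σ.real (Ioo s t) - κ.real (Ioo s t)| +
        lam / 2 * ∫ x in Ioo s t, ((if p ≤ x then σ.real (Ioo s t) - κ.real (Ioo s t) else 0) -
          (g x - cumul c σ κ s)) ^ 2 := by
  set I := Ioo s t with hI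
  set d := σ.real I - κ.real I with hd
  have hIm : MeasurableSet I := measurableSet_Ioo
  have hIab : I ⊆ Ioo a b := Ioo_subset_Ioo has htb
  -- Adding `d⁺` to one measure and `d⁻` to the other covers both signs of the net increment `d`,
  -- which is kept so that nothing changes outside `I`.
  set σ' := σ.restrict Iᶜ + ENNReal.ofReal d⁺ • Measure.dirac p with hσ'
  set κ' := κ.restrict Iᶜ + ENNReal.ofReal d⁻ • Measure.dirac p with hκ'
  have hfin : ∀ r : ℝ, IsFiniteMeasure (ENNReal.ofReal r • Measure.dirac p) := fun r =>
    Measure.smul_finite _ ENNReal.ofReal_ne_top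
  have hpab : p ∉ (Ioo a b)ᶜ := fun h => h (hIab hp)
  have hnull : ∀ (σ : Measure ℝ) (r : ℝ), σ (Ioo a b)ᶜ = 0 →
      (σ.restrict Iᶜ + ENNReal.ofReal r • Measure.dirac p) (Ioo a b)ᶜ = 0 := by
    intro σ r hσ
    have h1 : (σ.restrict Iᶜ) (Ioo a b)ᶜ = 0 :=
      le_antisymm ((Measure.restrict_apply_le _ _).trans hσ.le) bot_le
    rw [Measure.add_apply, h1, Measure.smul_apply,
      Measure.dirac_apply' _ measurableSet_Ioo.compl, indicator_of_notMem hpab]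
    simp
  have hmin := h.le c σ' κ' (hnull σ _ h.pos_null) (hnull κ _ h.neg_null)
  -- the variation
  have hsum : σ' + κ' = (σ + κ).restrict Iᶜ + ENNReal.ofReal |d| • Measure.dirac p := by
    rw [hσ', hκ', Measure.restrict_add, ← posPart_add_negPart d,
      ENNReal.ofReal_add (posPart_nonneg d) (negPart_nonneg d), add_smul]
    abel
  have hvar' : (varK K (σ' + κ')).toReal ≤ (varK K ((σ + κ).restrict Iᶜ)).toReal + K |d| := by
    have hle : varK K (σ' + κ') ≤ varK K ((σ + κ).restrict Iᶜ) + ENNReal.ofReal (K |d|) := by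
      rw [hsum]
      exact (varK_add_le hK1 hK2 _ _).trans
        (add_le_add le_rfl (varK_smul_dirac hK1 (abs_nonneg d) p))
    have hne := varK_ne_top hK1 hK2 hK3 ((σ + κ).restrict Iᶜ)
    have := ENNReal.toReal_mono (ENNReal.add_ne_top.2 ⟨hne, ENNReal.ofReal_ne_top⟩) hle
    rwa [ENNReal.toReal_add hne ENNReal.ofReal_ne_top,
      ENNReal.toReal_ofReal (hK1.nonneg (abs_nonneg d))] at this
  have hvar : (varK K (σ + κ)).toReal = (varK K (σ.restrict I + κ.restrict I)).toReal +
      (varK K ((σ + κ).restrict Iᶜ)).toReal := by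
    have hms : (σ + κ).restrict I ⟂ₘ (σ + κ).restrict Iᶜ := by
      refine ⟨Iᶜ, hIm.compl, ?_, ?_⟩
      · rw [Measure.restrict_apply hIm.compl]; simp
      · rw [compl_compl, Measure.restrict_apply hIm]; simp
    rw [← ENNReal.toReal_add (varK_ne_top hK1 hK2 hK3 _) (varK_ne_top hK1 hK2 hK3 _),
      ← Measure.restrict_add, ← varK_add_of_mutuallySingular hK1 _ _ hms,
      Measure.restrict_add_restrict_compl hIm]
  -- the fidelity term
  have hcum' : ∀ x, cumul c σ' κ' x = c + ((σ.restrict Iᶜ).real (Iic x)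
      - (κ.restrict Iᶜ).real (Iic x)) + if p ≤ x then d else 0 := by
    intro x
    rw [cumul, hσ', hκ', measureReal_add_apply, measureReal_add_apply,
      smul_dirac_real_Iic (posPart_nonneg d), smul_dirac_real_Iic (negPart_nonneg d)]
    split_ifs
    · nth_rewrite 3 [← posPart_sub_negPart d]; ring
    · ring
  have hcum : ∀ x, cumul c σ κ x = c + ((σ.restrict Iᶜ).real (Iic x)
      - (κ.restrict Iᶜ).real (Iic x)) + ((σ.restrict I).real (Iic x)
      - (κ.restrict I).real (Iic x)) := by
    intro x
    rw [cumul, real_Iic_eq_restrict_add σ (s := s) (t := t),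
      real_Iic_eq_restrict_add κ (s := s) (t := t)]
    ring
  have hout : ∀ x, x ∉ I → cumul c σ' κ' x = cumul c σ κ x := by
    intro x hx
    rw [hcum', hcum]
    congr 1
    by_cases hxs : x ≤ s
    · rw [restrict_Ioo_real_Iic_of_le _ hxs, restrict_Ioo_real_Iic_of_le _ hxs, if_neg, sub_zero]
      exact not_le.2 (hxs.trans_lt hp.1)
    · have hxt : t ≤ x := by
        by_contra hlt
        exact hx ⟨not_le.1 hxs, not_le.1 hlt⟩
      rw [restrict_Ioo_real_Iic_of_ge _ hxt, restrict_Ioo_real_Iic_of_ge _ hxt, if_pos]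
      exact hp.2.le.trans hxt
  have hin : ∀ x ∈ I, c + ((σ.restrict Iᶜ).real (Iic x) - (κ.restrict Iᶜ).real (Iic x))
      = cumul c σ κ s := by
    intro x hx
    rw [restrict_compl_Ioo_real_Iic σ hx, restrict_compl_Ioo_real_Iic κ hx, cumul]
  have hsplit : ∀ (σ κ : Measure ℝ) [IsFiniteMeasure σ] [IsFiniteMeasure κ],
      ∫ x in Ioo a b, (cumul c σ κ x - g x) ^ 2 =
        (∫ x in I, (cumul c σ κ x - g x) ^ 2) + ∫ x in Ioo a b \ I, (cumul c σ κ x - g x) ^ 2 := by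
    intro σ κ _ _
    have := integral_inter_add_sdiff (s := Ioo a b) hIm (integrableOn_sq_cumul_sub hg c σ κ)
    rw [inter_eq_right.2 hIab] at this
    exact this.symm
  rw [hsplit σ κ, hsplit σ' κ'] at hmin
  have e1 : ∫ x in Ioo a b \ I, (cumul c σ' κ' x - g x) ^ 2
      = ∫ x in Ioo a b \ I, (cumul c σ κ x - g x) ^ 2 :=
    setIntegral_congr_fun (measurableSet_Ioo.diff hIm) fun x hx => by
      simp only [hout x hx.2]
  have e2 : ∫ x in I, (cumul c σ' κ' x - g x) ^ 2
      = ∫ x in I, ((if p ≤ x then d else 0) - (g x - cumul c σ κ s)) ^ 2 :=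
    setIntegral_congr_fun hIm fun x hx => by
      simp only [hcum', hin x hx]; ring
  have e3 : ∫ x in I, (cumul c σ κ x - g x) ^ 2
      = ∫ x in I, (cumul 0 (σ.restrict I) (κ.restrict I) x - (g x - cumul c σ κ s)) ^ 2 :=
    setIntegral_congr_fun hIm fun x hx => by
      have e : cumul 0 (σ.restrict I) (κ.restrict I) x
          = (σ.restrict I).real (Iic x) - (κ.restrict I).real (Iic x) := zero_add _
      rw [hcum x, hin x hx, e]; ring
  rw [e1, e2, e3] at hmin
  linarith

theorem measure_inter_compl_of_restrict {μ : Measure ℝ} {I : Set ℝ} {x₀ : ℝ}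
    (h : μ.restrict I {x₀}ᶜ = 0) : μ (I \ {x₀}) = 0 := by
  rw [Measure.restrict_apply (measurableSet_singleton x₀).compl] at h
  refine measure_mono_null ?_ h
  intro y hy
  exact ⟨hy.2, hy.1⟩

/-- On a short interval an optimal function has at most one jump and is constant otherwise. -/
theorem IsMinimalPair.exists_atom (hK1 : CondK1 K) (hK2 : CondK2 K) (hK3 : CondK3 K)
    (hlam : 0 < lam) (hg : ContinuousOn g (Icc a b)) (h : IsMinimalPair K lam g a b c σ κ)
    {s t : ℝ} (has : a ≤ s) (hst : s < t) (htb : t ≤ b) {M C c₀ : ℝ} (hC : IsMergeConst K M C)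
    (hc₀ : ∀ ρ ∈ Icc 0 M, c₀ * ρ ≤ K ρ) (hσM : σ.real (Ioo s t) ≤ M)
    (hκM : κ.real (Ioo s t) ≤ M) (h1 : ∀ x ∈ Ioo s t, |cumul c σ κ x - g x| ≤ M)
    (h2 : ∀ x ∈ Ioo s t, |cumul c σ κ s - g x| ≤ M)
    (h3 : ∀ x ∈ Ioo s t, |cumul c σ κ s + (σ.real (Ioo s t) - κ.real (Ioo s t)) - g x| ≤ M)
    (hl1 : lam * (t - s) < 2 * C) (hl2 : lam * (t - s) * M < c₀) :
    ∃ x₀, (σ + κ) (Ioo s t \ {x₀}) = 0 := by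
  set I := Ioo s t with hI
  set σI := σ.restrict I with hσI
  set κI := κ.restrict I with hκI
  have hIm : MeasurableSet I := measurableSet_Ioo
  have eσ : σI.real univ = σ.real I := by rw [hσI, measureReal_restrict_apply_univ]
  have eκ : κI.real univ = κ.real I := by rw [hκI, measureReal_restrict_apply_univ]
  have hmin := fun p hp => h.le_single_jump hK1 hK2 hK3 hg has htb (p := p) hp
  have hv : (varK K (σI + κI)).toReal = (varK K σI).toReal + (varK K κI).toReal := by
    rw [varK_add_of_mutuallySingular hK1 _ _
      ((h.mutuallySingular.mono_ac Measure.restrict_le_self.absolutelyContinuous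
        Measure.restrict_le_self.absolutelyContinuous)),
      ENNReal.toReal_add (varK_ne_top hK1 hK2 hK3 _) (varK_ne_top hK1 hK2 hK3 _)]
  have vσ := le_toReal_varK hK1 hK2 hK3 σI hC (eσ ▸ hσM)
  have vκ := le_toReal_varK hK1 hK2 hK3 κI hC (eκ ▸ hκM)
  have hsq : ∀ (τ : Measure ℝ) [IsFiniteMeasure τ],
      0 ≤ C / 2 * (τ.real univ ^ 2 - ∑' x, τ.real {x} ^ 2) := by
    intro τ _
    refine mul_nonneg (half_pos hC.1).le (sub_nonneg.2 ?_)
    refine (tsum_real_singleton_sq_le τ 0).trans ?_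
    have i1 : τ.real (Iic 0) ≤ τ.real univ := measureReal_mono (subset_univ _)
    have i2 : 0 ≤ τ.real (Iic 0) := measureReal_nonneg
    nlinarith
  have lσ := hc₀ (σI.real univ) ⟨measureReal_nonneg, eσ ▸ hσM⟩
  have lκ := hc₀ (κI.real univ) ⟨measureReal_nonneg, eκ ▸ hκM⟩
  have hGm : AEStronglyMeasurable (fun x => g x - cumul c σ κ s) (volume.restrict I) :=
    (aestronglyMeasurable_of_continuousOn_Icc (hg.mono (Icc_subset_Icc has htb))).sub
      aestronglyMeasurable_const
  have hcum : ∀ x ∈ I, cumul 0 σI κI x = cumul c σ κ x - cumul c σ κ s := by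
    intro x hx
    simp only [cumul]
    rw [real_Iic_eq_restrict_add σ (s := s) (t := t), real_Iic_eq_restrict_add κ (s := s) (t := t),
      restrict_compl_Ioo_real_Iic σ hx, restrict_compl_Ioo_real_Iic κ hx]
    ring
  have nσ : σI Iᶜ = 0 := by rw [hσI, Measure.restrict_apply hIm.compl]; simp
  have nκ : κI Iᶜ = 0 := by rw [hκI, Measure.restrict_apply hIm.compl]; simp
  have hnull : ∀ {τ : Measure ℝ} [IsFiniteMeasure τ], (τ.restrict I).real univ = 0 → τ I = 0 := by
    intro τ _ h0
    rw [measureReal_restrict_apply_univ] at h0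
    exact (measureReal_eq_zero_iff).1 h0
  -- The second case follows from the first by reflecting values: `σ` and `κ` are exchanged and `g`
  -- changes sign.
  rcases le_total (κI.real univ) (σI.real univ) with hd | hd
  · have hdn : 0 ≤ σI.real univ - κI.real univ := sub_nonneg.2 hd
    obtain ⟨z1, z2⟩ := single_atom_of_jump_le σI κI hst nσ hGm (M := M) (C := C) (c := c₀) (K := K)
      (S := (varK K (σI + κI)).toReal) hlam hd
      (hK1.mono hdn (sub_le_self _ measureReal_nonneg))
      (fun x hx => by rw [hcum x hx]; convert h1 x hx using 2; ring)
      (fun x hx => by rw [abs_sub_comm]; exact h2 x hx)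
      (fun x hx => by rw [eσ, eκ]; convert h3 x hx using 2; ring)
      -- For the smaller measure only `K N ≥ c₀ N` is used; its own defect is nonnegative and
      -- dropped.
      (by have := hsq κI; rw [hv]; linarith)
      (fun p hp => by
        have := hmin p hp
        rw [← eσ, ← eκ, abs_of_nonneg hdn] at this
        exact this) hl1 hl2
    obtain ⟨x₀, hx₀⟩ := exists_singleton_of_sq_eq σI z2
    refine ⟨x₀, ?_⟩
    rw [Measure.add_apply, measure_inter_compl_of_restrict hx₀,
      measure_mono_null sdiff_subset (hnull z1), add_zero]
  · have hdn : 0 ≤ κI.real univ - σI.real univ := sub_nonneg.2 hd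
    have hswap : ∀ x, cumul 0 κI σI x = -cumul 0 σI κI x := fun x => by simp only [cumul]; ring
    obtain ⟨z1, z2⟩ := single_atom_of_jump_le κI σI hst nκ hGm.neg (M := M) (C := C) (c := c₀)
      (K := K) (S := (varK K (σI + κI)).toReal) hlam hd
      (hK1.mono hdn (sub_le_self _ measureReal_nonneg))
      (fun x hx => by
        rw [hswap, hcum x hx, ← abs_neg]; convert h1 x hx using 2
        simp only [Pi.neg_apply]; ring)
      (fun x hx => by
        convert h2 x hx using 2
        simp only [Pi.neg_apply]; ring)
      (fun x hx => by
        rw [eσ, eκ, ← abs_neg]; convert h3 x hx using 2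
        simp only [Pi.neg_apply]; ring)
      (by have := hsq σI; rw [hv]; linarith)
      (fun p hp => by
        have := hmin p hp
        rw [← eσ, ← eκ, abs_sub_comm, abs_of_nonneg hdn] at this
        convert this using 3
        · refine integral_congr_ae (Eventually.of_forall fun x => ?_)
          simp only [hswap, Pi.neg_apply]; ring
        · refine integral_congr_ae (Eventually.of_forall fun x => ?_)
          simp only [Pi.neg_apply]
          split_ifs <;> ring) hl1 hl2
    obtain ⟨x₀, hx₀⟩ := exists_singleton_of_sq_eq κI z2
    refine ⟨x₀, ?_⟩
    rw [Measure.add_apply, measure_inter_compl_of_restrict hx₀,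
      measure_mono_null sdiff_subset (hnull z1), add_zero]

end Merge

/-! ### Finiteness of the jump set. -/

section FiniteSupport

variable {K : ℝ → ℝ} {lam : ℝ} {g : ℝ → ℝ} {a b c : ℝ} {σ κ : Measure ℝ} [IsFiniteMeasure σ]
  [IsFiniteMeasure κ]

/-- Every interval of length at most some fixed `ℓ` carries at most one atom and nothing else;
compactness of `[a, b]` does the rest. The range bound is not yet available, so `M` is crude. -/
theorem IsMinimalPair.exists_finset (hK1 : CondK1 K) (hK2 : CondK2 K) (hK3 : CondK3 K)
    (hlam : 0 < lam) (hg : ContinuousOn g (Icc a b)) (h : IsMinimalPair K lam g a b c σ κ) :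
    ∃ F : Finset ℝ, (σ + κ) (Ioo a b \ F) = 0 := by
  obtain ⟨B, hB⟩ := isCompact_Icc.exists_bound_of_continuousOn hg
  set T := σ.real univ + κ.real univ with hT
  have hσ0 : 0 ≤ σ.real univ := measureReal_nonneg
  have hκ0 : 0 ≤ κ.real univ := measureReal_nonneg
  -- The function is bounded by `|c| + T`, an increment by `T`, and `g` by `|B|`; the `1` makes `M`
  -- positive.
  set M := |c| + 2 * T + |B| + 1 with hM
  have hM0 : 0 < M := by positivity
  obtain ⟨C, hC⟩ := hK2 M hM0
  obtain ⟨c₀, hc₀, hc₀K⟩ := exists_linear_lower_bound hK1 hK3 hM0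
  have hC0 := hC.1
  -- Half of the critical length, so that `t - s ≤ ℓ` yields the strict inequalities.
  set ℓ := min (2 * C) (c₀ / M) / lam / 2 with hℓ
  have hℓ0 : 0 < ℓ := by
    have : 0 < min (2 * C) (c₀ / M) := lt_min (by positivity) (by positivity)
    positivity
  have hℓ2 : lam * (2 * ℓ) = min (2 * C) (c₀ / M) := by rw [hℓ]; field_simp
  have hshort : ∀ s t, t - s ≤ ℓ → a ≤ s → t ≤ b → ∃ F : Finset ℝ, (σ + κ) (Ioo s t \ F) = 0 := by
    intro s t hts has htb
    rcases le_or_gt t s with hle | hst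
    · exact ⟨∅, by simp [Ioo_eq_empty (not_lt.2 hle)]⟩
    have hlt : lam * (t - s) < min (2 * C) (c₀ / M) := by
      rw [← hℓ2]
      exact mul_lt_mul_of_pos_left (by linarith) hlam
    have hgB : ∀ x ∈ Ioo s t, |g x| ≤ |B| := fun x hx =>
      (hB x ⟨has.trans hx.1.le, hx.2.le.trans htb⟩).trans (le_abs_self B)
    have hsub : ∀ (τ : Measure ℝ) [IsFiniteMeasure τ] (A : Set ℝ), τ.real A ≤ τ.real univ :=
      fun τ _ A => measureReal_mono (subset_univ _)
    have hc0 := abs_nonneg c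
    have hBn := abs_nonneg B
    have hV : ∀ x, |cumul c σ κ x| ≤ |c| + T := abs_cumul_le c σ κ
    obtain ⟨x₀, hx₀⟩ := h.exists_atom hK1 hK2 hK3 hlam hg has hst htb (M := M) (C := C)
      (c₀ := c₀) hC hc₀K ((hsub σ _).trans (by linarith)) ((hsub κ _).trans (by linarith))
      (fun x hx => (abs_sub _ _).trans (by have := hV x; have := hgB x hx; linarith))
      (fun x hx => (abs_sub _ _).trans (by have := hV s; have := hgB x hx; linarith))
      (fun x hx => by
        refine (abs_sub _ _).trans ?_
        have i1 := abs_add_le (cumul c σ κ s) (σ.real (Ioo s t) - κ.real (Ioo s t))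
        have i2 : |σ.real (Ioo s t) - κ.real (Ioo s t)| ≤ T := by
          have j1 := hsub σ (Ioo s t)
          have j2 := hsub κ (Ioo s t)
          have j3 : 0 ≤ σ.real (Ioo s t) := measureReal_nonneg
          have j4 : 0 ≤ κ.real (Ioo s t) := measureReal_nonneg
          rw [abs_le]; constructor <;> linarith
        have := hV s
        have := hgB x hx
        linarith)
      (hlt.trans_le (min_le_left _ _))
      ((lt_div_iff₀ hM0).1 (hlt.trans_le (min_le_right _ _)))
    exact ⟨{x₀}, by simpa using hx₀⟩
  have key : ∃ F : Finset ℝ, (σ + κ) ((Icc a b ∩ Ioo a b) \ F) = 0 := by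
    refine isCompact_Icc.induction_on (p := fun S => ∃ F : Finset ℝ,
      (σ + κ) ((S ∩ Ioo a b) \ F) = 0) ⟨∅, by simp⟩ ?_ ?_ ?_
    · rintro S S' hSS' ⟨F, hF⟩
      exact ⟨F, measure_mono_null (sdiff_subset_sdiff_left (inter_subset_inter_left _ hSS')) hF⟩
    · rintro S S' ⟨F, hF⟩ ⟨F', hF'⟩
      classical
      refine ⟨F ∪ F', measure_mono_null ?_ (measure_union_null hF hF')⟩
      rintro x ⟨⟨hx1, hx2⟩, hx3⟩
      rw [Finset.mem_coe, Finset.mem_union, not_or] at hx3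
      rcases hx1 with hx1 | hx1
      · exact Or.inl ⟨⟨hx1, hx2⟩, hx3.1⟩
      · exact Or.inr ⟨⟨hx1, hx2⟩, hx3.2⟩
    · intro x hx
      refine ⟨Ioo (x - ℓ / 2) (x + ℓ / 2),
        mem_nhdsWithin_of_mem_nhds (Ioo_mem_nhds (by linarith) (by linarith)), ?_⟩
      rw [Ioo_inter_Ioo]
      refine hshort _ _ ?_ (le_max_right _ _) (min_le_right _ _)
      have i1 : min (x + ℓ / 2) b ≤ x + ℓ / 2 := min_le_left _ _
      have i2 : x - ℓ / 2 ≤ max (x - ℓ / 2) a := le_max_left _ _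
      change min (x + ℓ / 2) b - max (x - ℓ / 2) a ≤ ℓ
      linarith
  rwa [inter_eq_right.2 Ioo_subset_Icc_self] at key

/-- The derivative of an optimal function is a finite sum of point masses. -/
theorem IsMinimalPair.exists_atoms_finset (hK1 : CondK1 K) (hK2 : CondK2 K) (hK3 : CondK3 K)
    (hlam : 0 < lam) (hg : ContinuousOn g (Icc a b)) (h : IsMinimalPair K lam g a b c σ κ) :
    ∃ J : Finset ℝ, (∀ x, x ∈ J ↔ (σ + κ) {x} ≠ 0) ∧ (∀ x ∈ J, x ∈ Ioo a b) ∧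
      (σ + κ) (J : Set ℝ)ᶜ = 0 := by
  classical
  obtain ⟨F, hF⟩ := h.exists_finset hK1 hK2 hK3 hlam hg
  have hout : (σ + κ) (Ioo a b)ᶜ = 0 := by
    rw [Measure.add_apply, h.pos_null, h.neg_null, add_zero]
  have hFc : (σ + κ) (F : Set ℝ)ᶜ = 0 := by
    refine measure_mono_null ?_ (measure_union_null hF hout)
    intro x hx
    by_cases hx' : x ∈ Ioo a b
    · exact Or.inl ⟨hx', hx⟩
    · exact Or.inr hx'
  have hmem : ∀ x, x ∈ F.filter (fun x => (σ + κ) {x} ≠ 0) ↔ (σ + κ) {x} ≠ 0 := by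
    intro x
    rw [Finset.mem_filter, and_iff_right_iff_imp]
    intro hx
    by_contra hxF
    exact hx (measure_mono_null (singleton_subset_iff.2 hxF) hFc)
  refine ⟨F.filter fun x => (σ + κ) {x} ≠ 0, hmem, fun x hx => ?_, ?_⟩
  · by_contra hxI
    exact (hmem x).1 hx (measure_mono_null (singleton_subset_iff.2 hxI) hout)
  · have h0 : (σ + κ) (F.filter fun x => (σ + κ) {x} = 0 : Finset ℝ) = 0 := by
      rw [← sum_measure_singleton]
      exact Finset.sum_eq_zero fun x hx => (Finset.mem_filter.1 hx).2
    refine measure_mono_null ?_ (measure_union_null hFc h0)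
    intro x hx
    by_cases hxF : x ∈ F
    · refine Or.inr ?_
      rw [Finset.mem_coe, Finset.mem_filter]
      refine ⟨hxF, ?_⟩
      by_contra h'
      exact hx ((hmem x).2 h')
    · exact Or.inl hxF

end FiniteSupport

/-! ### Step functions composed with Lipschitz maps. -/

section Step

/-- A right-continuous step function, composed with any `f`, is a step function. -/
theorem comp_step_eq (f : ℝ → ℝ) (c : ℝ) (w : ℝ → ℝ) (F : Finset ℝ) (x : ℝ) :
    f (c + ∑ z ∈ F with z ≤ x, w z) = f c + ∑ y ∈ F with y ≤ x,
      (f (c + ∑ z ∈ F with z ≤ y, w z) - f (c + ∑ z ∈ F with z ≤ y, w z - w y)) := by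
  induction F using Finset.induction_on_max generalizing x with
  | empty => simp
  | insert m F hm ih =>
    have hmF : m ∉ F := fun h => lt_irrefl _ (hm m h)
    have hlt : ∀ y, y < m → (insert m F).filter (· ≤ y) = F.filter (· ≤ y) := fun y hy =>
      by rw [Finset.filter_insert, if_neg (not_le.2 hy)]
    have hge : ∀ y, m ≤ y → (insert m F).filter (· ≤ y) = insert m F := fun y hy =>
      Finset.filter_true_of_mem fun z hz => by
        rcases Finset.mem_insert.1 hz with rfl | hz
        · exact hy
        · exact (hm z hz).le.trans hy
    have hge' : ∀ y, m ≤ y → F.filter (· ≤ y) = F := fun y hy =>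
      Finset.filter_true_of_mem fun z hz => (hm z hz).le.trans hy
    have hsum : ∀ A : Finset ℝ, A ⊆ F → ∑ y ∈ A, (f (c + ∑ z ∈ insert m F with z ≤ y, w z)
        - f (c + ∑ z ∈ insert m F with z ≤ y, w z - w y)) =
        ∑ y ∈ A, (f (c + ∑ z ∈ F with z ≤ y, w z) - f (c + ∑ z ∈ F with z ≤ y, w z - w y)) :=
      fun A hA => Finset.sum_congr rfl fun y hy => by rw [hlt y (hm y (hA hy))]
    rcases lt_or_ge x m with hx | hx
    · rw [hlt x hx, hsum _ (Finset.filter_subset _ _)]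
      exact ih x
    · have h1 := ih m
      rw [hge' m le_rfl] at h1
      rw [hge x hx, Finset.sum_insert hmF, Finset.sum_insert hmF, hsum _ (Finset.Subset.refl _),
        hge m le_rfl, Finset.sum_insert hmF]
      have e : c + (w m + ∑ z ∈ F, w z) - w m = c + ∑ z ∈ F, w z := by ring
      rw [e]
      linarith

variable {c : ℝ} {σ κ : Measure ℝ} [IsFiniteMeasure σ] [IsFiniteMeasure κ] {J : Finset ℝ}

omit [IsFiniteMeasure σ] [IsFiniteMeasure κ] in
theorem measure_null_of_add_null {s : Set ℝ} (h : (σ + κ) s = 0) : σ s = 0 ∧ κ s = 0 := by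
  rwa [Measure.add_apply, add_eq_zero] at h

theorem real_eq_sum_of_compl_null (hJ : σ (J : Set ℝ)ᶜ = 0) (s : Set ℝ) [DecidablePred (· ∈ s)] :
    σ.real s = ∑ y ∈ J with y ∈ s, σ.real {y} := by
  rw [sum_measureReal_singleton, measureReal_def, measureReal_def,
    ← measure_inter_conull' (s := s) (t := (J : Set ℝ)) (measure_mono_null (fun x hx => hx.2) hJ)]
  congr 2
  ext x
  simp [and_comm]

theorem cumul_eq_sum (hJ : (σ + κ) (J : Set ℝ)ᶜ = 0) (x : ℝ) :
    cumul c σ κ x = c + ∑ y ∈ J with y ≤ x, (σ.real {y} - κ.real {y}) := by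
  classical
  rw [cumul, real_eq_sum_of_compl_null (measure_null_of_add_null hJ).1,
    real_eq_sum_of_compl_null (measure_null_of_add_null hJ).2, Finset.sum_sub_distrib]
  rfl

/-- Composing a step function with a `1`-Lipschitz function does not increase the `K`-variation. -/
theorem exists_cumul_eq_comp (hJ : (σ + κ) (J : Set ℝ)ᶜ = 0) {f : ℝ → ℝ}
    (hf : ∀ x y, |f x - f y| ≤ |x - y|) :
    ∃ (σ' κ' : Measure ℝ) (_ : IsFiniteMeasure σ') (_ : IsFiniteMeasure κ'),
      σ' + κ' ≤ σ + κ ∧ ∀ x, cumul (f c) σ' κ' x = f (cumul c σ κ x) := by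
  classical
  set w : ℝ → ℝ := fun y => σ.real {y} - κ.real {y} with hw
  -- The jump of the composition at `y`: subtracting `w y` gives the left limit of the step function
  -- when `y ∈ J`.
  set v : ℝ → ℝ := fun y => f (c + ∑ z ∈ J with z ≤ y, w z)
    - f (c + ∑ z ∈ J with z ≤ y, w z - w y) with hv
  have hvw : ∀ y, |v y| ≤ (σ + κ).real {y} := by
    intro y
    refine (hf _ _).trans ?_
    rw [sub_sub_cancel, measureReal_add_apply, hw]
    have i1 : 0 ≤ σ.real {y} := measureReal_nonneg
    have i2 : 0 ≤ κ.real {y} := measureReal_nonneg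
    rw [abs_le]; constructor <;> linarith
  have hfin : ∀ r : ℝ → ℝ,
      IsFiniteMeasure (∑ y ∈ J, ENNReal.ofReal (r y) • Measure.dirac y) := by
    intro r
    refine ⟨?_⟩
    rw [Measure.finsetSum_apply]
    refine ENNReal.sum_lt_top.2 fun y _ => ?_
    simp
  have hreal : ∀ r : ℝ → ℝ, (∀ y, 0 ≤ r y) → ∀ x,
      (∑ y ∈ J, ENNReal.ofReal (r y) • Measure.dirac y).real (Iic x) = ∑ y ∈ J with y ≤ x, r y := by
    intro r hr x
    rw [measureReal_def, Measure.finsetSum_apply, ENNReal.toReal_sum (fun y _ => by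
      have := Measure.smul_finite (Measure.dirac y) (ENNReal.ofReal_ne_top (r := r y))
      exact measure_ne_top _ _), Finset.sum_filter]
    exact Finset.sum_congr rfl fun y _ => smul_dirac_real_Iic (hr y) y
  refine ⟨_, _, hfin fun y => (v y)⁺, hfin fun y => (v y)⁻, ?_, ?_⟩
  · rw [← Finset.sum_add_distrib]
    refine Measure.le_iff.2 fun s hs => ?_
    rw [Measure.finsetSum_apply]
    calc ∑ y ∈ J, (ENNReal.ofReal (v y)⁺ • Measure.dirac y
            + ENNReal.ofReal (v y)⁻ • Measure.dirac y) s
        ≤ ∑ y ∈ J, if y ∈ s then (σ + κ) {y} else 0 := by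
          refine Finset.sum_le_sum fun y _ => ?_
          rw [← add_smul, ← ENNReal.ofReal_add (posPart_nonneg _) (negPart_nonneg _),
            posPart_add_negPart, Measure.smul_apply, Measure.dirac_apply' _ hs]
          by_cases hy : y ∈ s
          · rw [if_pos hy, indicator_of_mem hy, Pi.one_apply, smul_eq_mul, mul_one]
            refine (ENNReal.ofReal_le_ofReal (hvw y)).trans ?_
            exact ENNReal.ofReal_toReal_le
          · simp [hy]
      _ = ∑ y ∈ J with y ∈ s, (σ + κ) {y} := (Finset.sum_filter _ _).symm
      _ = (σ + κ) (J.filter (· ∈ s) : Finset ℝ) := sum_measure_singleton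
      _ ≤ (σ + κ) s := measure_mono fun y hy => (Finset.mem_filter.1 hy).2
  · intro x
    rw [cumul_eq_sum hJ, comp_step_eq f c w J x, cumul, hreal _ (fun y => posPart_nonneg _),
      hreal _ (fun y => negPart_nonneg _), ← Finset.sum_sub_distrib]
    congr 1
    exact Finset.sum_congr rfl fun y _ => posPart_sub_negPart _

end Step

/-! ### The minimizer stays in the range of the data. -/

section Range

variable {K : ℝ → ℝ} {lam : ℝ} {g : ℝ → ℝ} {a b c : ℝ} {σ κ : Measure ℝ} [IsFiniteMeasure σ]
  [IsFiniteMeasure κ]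

theorem abs_clip_sub_le (lo hi x y : ℝ) :
    |max lo (min hi x) - max lo (min hi y)| ≤ |x - y| := by
  refine (abs_max_sub_max_le_max _ _ _ _).trans ?_
  rw [sub_self, abs_zero]
  refine max_le (abs_nonneg _) ((abs_min_sub_min_le_max _ _ _ _).trans ?_)
  rw [sub_self, abs_zero]
  exact max_le (abs_nonneg _) le_rfl

theorem sq_clip_sub_le {lo hi x y : ℝ} (h1 : lo ≤ y) (h2 : y ≤ hi) :
    (max lo (min hi x) - y) ^ 2 ≤ (x - y) ^ 2 ∧
      ((max lo (min hi x) - y) ^ 2 = (x - y) ^ 2 → x ∈ Icc lo hi) := by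
  rcases le_total x hi with h | h
  · rw [min_eq_right h]
    rcases le_total lo x with h' | h'
    · rw [max_eq_right h']
      exact ⟨le_rfl, fun _ => ⟨h', h⟩⟩
    · rw [max_eq_left h']
      refine ⟨by nlinarith, fun he => ?_⟩
      have : lo = x := by nlinarith
      exact ⟨this.le, h⟩
  · rw [min_eq_left h, max_eq_right (h1.trans h2)]
    refine ⟨by nlinarith, fun he => ?_⟩
    have : hi = x := by nlinarith
    exact ⟨(h1.trans h2).trans h, this.ge⟩

/-- Truncation to `[lo, hi]` is `1`-Lipschitz, so it does not raise the variation, and it brings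
values closer to `g`, strictly so where they left the interval. Minimality makes the fidelity terms
equal, hence the range bound holds a.e., and everywhere by one-sided continuity. -/
theorem IsMinimalPair.cumul_mem_Icc (hK1 : CondK1 K) (hK2 : CondK2 K) (hK3 : CondK3 K)
    (hab : a < b) (hlam : 0 < lam) (hg : ContinuousOn g (Icc a b))
    (h : IsMinimalPair K lam g a b c σ κ) {lo hi : ℝ} (hgI : ∀ x ∈ Icc a b, g x ∈ Icc lo hi)
    {x : ℝ} (hx : x ∈ Icc a b) : cumul c σ κ x ∈ Icc lo hi := by
  obtain ⟨J, -, -, hJ⟩ := h.exists_atoms_finset hK1 hK2 hK3 hlam hg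
  set f : ℝ → ℝ := fun x => max lo (min hi x) with hf
  obtain ⟨σ', κ', _, _, hle, hcum⟩ := exists_cumul_eq_comp (c := c) hJ (f := f)
    (abs_clip_sub_le lo hi)
  have hnull : (σ' + κ') (Ioo a b)ᶜ = 0 := by
    refine le_antisymm ((hle _).trans ?_) bot_le
    rw [Measure.add_apply, h.pos_null, h.neg_null, add_zero]
  have hmin := h.le (f c) σ' κ' (measure_null_of_add_null hnull).1
    (measure_null_of_add_null hnull).2
  have hvar : (varK K (σ' + κ')).toReal ≤ (varK K (σ + κ)).toReal :=
    ENNReal.toReal_mono (varK_ne_top hK1 hK2 hK3 _) (varK_mono hK1 _ _ hle)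
  have hint := integrableOn_sq_cumul_sub hg c σ κ
  have hint' := integrableOn_sq_cumul_sub hg (f c) σ' κ'
  have hpt : ∀ x ∈ Ioo a b, (cumul (f c) σ' κ' x - g x) ^ 2 ≤ (cumul c σ κ x - g x) ^ 2 ∧
      ((cumul (f c) σ' κ' x - g x) ^ 2 = (cumul c σ κ x - g x) ^ 2 →
        cumul c σ κ x ∈ Icc lo hi) := by
    intro x hx
    have := hgI x (Ioo_subset_Icc_self hx)
    rw [hcum]
    exact sq_clip_sub_le this.1 this.2
  have hnn : 0 ≤ᵐ[volume.restrict (Ioo a b)]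
      fun x => (cumul c σ κ x - g x) ^ 2 - (cumul (f c) σ' κ' x - g x) ^ 2 := by
    filter_upwards [ae_restrict_mem measurableSet_Ioo] with x hx
    exact sub_nonneg.2 (hpt x hx).1
  have hzero : ∫ x in Ioo a b,
      ((cumul c σ κ x - g x) ^ 2 - (cumul (f c) σ' κ' x - g x) ^ 2) = 0 := by
    refine le_antisymm ?_ (integral_nonneg_of_ae hnn)
    rw [integral_sub hint hint']
    have : lam / 2 * ((∫ x in Ioo a b, (cumul c σ κ x - g x) ^ 2)
        - ∫ x in Ioo a b, (cumul (f c) σ' κ' x - g x) ^ 2) ≤ 0 := by linarith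
    exact nonpos_of_mul_nonpos_right this (half_pos hlam)
  have hae : ∀ᵐ x ∂volume.restrict (Ioo a b), cumul c σ κ x ∈ Icc lo hi := by
    filter_upwards [(integral_eq_zero_iff_of_nonneg_ae hnn (hint.sub hint')).1 hzero,
      ae_restrict_mem measurableSet_Ioo] with x h0 hx
    exact (hpt x hx).2 (sub_eq_zero.1 h0).symm
  rcases hx.2.lt_or_eq with hxb | rfl
  · exact isClosed_Icc.mem_of_frequently_of_tendsto
      (frequently_nhdsGT_of_ae hae ⟨hx.1, hxb⟩) (tendsto_cumul_right c σ κ x)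
  -- At the right endpoint only the left limit is at hand; it is the value, since there is no atom
  -- there.
  · have := isClosed_Icc.mem_of_frequently_of_tendsto
      (frequently_nhdsLT_of_ae hae (right_mem_Ioc.2 hab)) (tendsto_cumul_left c σ κ x)
    have hx0 : ∀ (τ : Measure ℝ) [IsFiniteMeasure τ], τ (Ioo a x)ᶜ = 0 → τ.real {x} = 0 :=
      fun τ _ hτ => (measureReal_eq_zero_iff).2
        (measure_mono_null (t := (Ioo a x)ᶜ)
          (singleton_subset_iff.2 fun h => lt_irrefl x h.2) hτ)
    rwa [hx0 σ h.pos_null, hx0 κ h.neg_null, sub_zero, sub_zero] at this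

end Range

/-! ### Separated finite sets and partitions. -/

section Separation

/-- For `δ ≥ 0` the intervals `[y, y + δ)` pack disjointly into `[a, b]`. The induction removes the
largest point `m` and applies the bound with `b` replaced by `m`. -/
theorem card_mul_le_of_separated {δ a : ℝ} (F : Finset ℝ)
    (hsep : ∀ p ∈ F, ∀ q ∈ F, p < q → p + δ ≤ q) {b : ℝ} (hab : a ≤ b)
    (hF : ∀ y ∈ F, a ≤ y ∧ y + δ ≤ b) : F.card * δ ≤ b - a := by
  induction F using Finset.induction_on_max generalizing b with
  | empty => simpa using hab
  | insert m F hm ih =>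
    have hmF : m ∉ F := fun h => lt_irrefl _ (hm m h)
    have h1 := hF m (Finset.mem_insert_self m F)
    have h2 := ih (fun p hp q hq => hsep p (Finset.mem_insert_of_mem hp) q
      (Finset.mem_insert_of_mem hq)) h1.1 fun y hy =>
        ⟨(hF y (Finset.mem_insert_of_mem hy)).1,
          hsep y (Finset.mem_insert_of_mem hy) m (Finset.mem_insert_self m F) (hm y hy)⟩
    rw [Finset.card_insert_of_notMem hmF]
    push_cast
    linarith [h1.2]

theorem separated_of_consecutive {δ : ℝ} {F : Finset ℝ}
    (h : ∀ p ∈ F, ∀ q ∈ F, p < q → (∀ z ∈ F, z ∉ Ioo p q) → p + δ ≤ q) :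
    ∀ p ∈ F, ∀ q ∈ F, p < q → p + δ ≤ q := by
  intro p hp q hq hpq
  have hne : (F.filter (p < ·)).Nonempty := ⟨q, Finset.mem_filter.2 ⟨hq, hpq⟩⟩
  obtain ⟨hm, hpm⟩ := Finset.mem_filter.1 (Finset.min'_mem _ hne)
  refine (h p hp _ hm hpm fun z hz hzI => ?_).trans
    (Finset.min'_le _ q (Finset.mem_filter.2 ⟨hq, hpq⟩))
  exact absurd (Finset.min'_le _ z (Finset.mem_filter.2 ⟨hz, hzI.1⟩)) (not_le.2 hzI.2)

theorem isPiecewiseConst_of_finset {a b : ℝ} (hab : a < b) {V : ℝ → ℝ} (F : Finset ℝ)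
    (hF : ∀ y ∈ F, y ∈ Ioo a b)
    (hV : ∀ x y, a < x → x ≤ y → y < b → (∀ z ∈ F, z ∉ Ioc x y) → V y = V x) :
    IsPiecewiseConst a b V := by
  have hconst : ∀ l r, (∀ x y, l < x → x ≤ y → y < r → V y = V x) →
      ∃ v, ∀ y ∈ Ioo l r, V y = v := by
    intro l r h
    refine ⟨V ((l + r) / 2), fun y hy => ?_⟩
    rcases le_total y ((l + r) / 2) with hle | hle
    · exact (h y _ hy.1 hle (by linarith [hy.1, hy.2])).symm
    · exact h _ y (by linarith [hy.1, hy.2]) hle hy.2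
  induction F using Finset.induction_on_max generalizing b with
  | empty =>
    refine ⟨1, fun i => if i = 0 then a else b, by simp, by simp, ?_, ?_⟩
    · intro i hi
      obtain rfl : i = 0 := by omega
      simpa using hab
    · intro i hi
      obtain rfl : i = 0 := by omega
      simpa using hconst a b fun x y h1 h2 h3 => hV x y h1 h2 h3 (by simp)
  | insert m F hm ih =>
    have hmI := hF m (Finset.mem_insert_self m F)
    obtain ⟨n, x, h0, hn, hlt, hc⟩ := ih hmI.1
      (fun y hy => ⟨(hF y (Finset.mem_insert_of_mem hy)).1, hm y hy⟩)
      (fun x y h1 h2 h3 h4 => hV x y h1 h2 (h3.trans hmI.2) fun z hz => by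
        rcases Finset.mem_insert.1 hz with rfl | hz
        · exact fun h => absurd h.2 (not_le.2 h3)
        · exact h4 z hz)
    refine ⟨n + 1, fun i => if i ≤ n then x i else b, by simpa using h0, by simp, ?_, ?_⟩
    · intro i hi
      rcases Nat.lt_succ_iff_lt_or_eq.1 hi with hi' | rfl
      · simpa [hi'.le, Nat.succ_le_of_lt hi'] using hlt i hi'
      · simpa [hn] using hmI.2
    · intro i hi
      rcases Nat.lt_succ_iff_lt_or_eq.1 hi with hi' | rfl
      · simpa [hi'.le, Nat.succ_le_of_lt hi'] using hc i hi'
      · simp only [le_refl, if_true, hn, Nat.not_succ_le_self, if_false]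
        refine hconst m b fun x y h1 h2 h3 => hV x y (hmI.1.trans h1) h2 h3 fun z hz h => ?_
        rcases Finset.mem_insert.1 hz with rfl | hz
        · exact absurd h.1 (not_lt.2 h1.le)
        · exact absurd (h.1.trans (hm z hz)) (not_lt.2 h1.le)

end Separation

/-! ### The distance between consecutive jumps. -/

section Jumps

variable {K : ℝ → ℝ} {lam : ℝ} {g : ℝ → ℝ} {a b c : ℝ} {σ κ : Measure ℝ} [IsFiniteMeasure σ]
  [IsFiniteMeasure κ] {J : Finset ℝ}

theorem cumul_sub_eq_sum (hJ : (σ + κ) (J : Set ℝ)ᶜ = 0) {x y : ℝ} (hxy : x ≤ y) :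
    cumul c σ κ y - cumul c σ κ x = ∑ z ∈ J with z ∈ Ioc x y, (σ.real {z} - κ.real {z}) := by
  classical
  have hdisj : Disjoint (J.filter (· ≤ x)) (J.filter (· ∈ Ioc x y)) := by
    refine Finset.disjoint_filter.2 fun z _ h1 h2 => absurd h1 (not_le.2 h2.1)
  have hunion : J.filter (· ≤ y) = (J.filter (· ≤ x)).disjUnion _ hdisj := by
    ext z
    simp only [Finset.mem_disjUnion, Finset.mem_filter, mem_Ioc]
    constructor
    · rintro ⟨h1, h2⟩
      rcases le_or_gt z x with h | h
      · exact Or.inl ⟨h1, h⟩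
      · exact Or.inr ⟨h1, h, h2⟩
    · rintro (⟨h1, h2⟩ | ⟨h1, -, h2⟩)
      · exact ⟨h1, h2.trans hxy⟩
      · exact ⟨h1, h2⟩
  rw [cumul_eq_sum hJ, cumul_eq_sum hJ, hunion, Finset.sum_disjUnion]
  ring

theorem continuousAt_cumul {x : ℝ} (hx : (σ + κ) {x} = 0) : ContinuousAt (cumul c σ κ) x := by
  rw [continuousAt_iff_continuous_left'_right']
  have h0 := measure_null_of_add_null hx
  refine ⟨?_, tendsto_cumul_right c σ κ x⟩
  have := tendsto_cumul_left c σ κ x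
  rwa [measureReal_def, measureReal_def, h0.1, h0.2, ENNReal.toReal_zero, sub_zero, sub_zero]
    at this

/-- Consecutive jumps of an optimal function are far apart. -/
theorem IsMinimalPair.min_le_of_consecutive (hK1 : CondK1 K) (hK2 : CondK2 K) (hK3 : CondK3 K)
    (hlam : 0 < lam) (hg : ContinuousOn g (Icc a b)) (h : IsMinimalPair K lam g a b c σ κ)
    (hJ : (σ + κ) (J : Set ℝ)ᶜ = 0) (hJpos : ∀ x ∈ J, (σ + κ) {x} ≠ 0)
    (hJab : ∀ x ∈ J, x ∈ Ioo a b) {lo hi M C c₀ : ℝ} (hgI : ∀ x ∈ Icc a b, g x ∈ Icc lo hi)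
    (hVI : ∀ x ∈ Icc a b, cumul c σ κ x ∈ Icc lo hi) (hM0 : 0 < M) (hM : hi - lo ≤ M)
    (hC : IsMergeConst K M C) (hc₀ : ∀ ρ ∈ Icc 0 M, c₀ * ρ ≤ K ρ) {p q : ℝ} (hp : p ∈ J)
    (hq : q ∈ J) (hpq : p < q) (hcons : ∀ z ∈ J, z ∉ Ioo p q) :
    min (c₀ / M) (2 * C) ≤ lam * (q - p) := by
  classical
  by_contra! hlt
  -- The comparison needs an open interval containing both jumps; the strict inequality leaves room
  -- to enlarge `[p, q]` without reaching a third jump.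
  obtain ⟨ε, hε, hεa, hεb, hεl, hεJ⟩ : ∃ ε > 0, a ≤ p - ε ∧ q + ε ≤ b ∧
      lam * (q + ε - (p - ε)) < min (c₀ / M) (2 * C) ∧
      ∀ z ∈ J, z ∈ Ioo (p - ε) (q + ε) → z = p ∨ z = q := by
    have e1 : ∀ᶠ ε in 𝓝[>] (0 : ℝ), a < p - ε :=
      nhdsWithin_le_nhds ((tendsto_const_nhds.sub tendsto_id).eventually
        (lt_mem_nhds (by simpa using (hJab p hp).1)))
    have e2 : ∀ᶠ ε in 𝓝[>] (0 : ℝ), q + ε < b :=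
      nhdsWithin_le_nhds ((tendsto_const_nhds.add tendsto_id).eventually
        (gt_mem_nhds (by simpa using (hJab q hq).2)))
    have e3 : ∀ᶠ ε in 𝓝[>] (0 : ℝ), lam * (q + ε - (p - ε)) < min (c₀ / M) (2 * C) := by
      have : Continuous fun ε : ℝ => lam * (q + ε - (p - ε)) := by fun_prop
      exact nhdsWithin_le_nhds (this.continuousAt.eventually (gt_mem_nhds (by simpa using hlt)))
    have e4 : ∀ᶠ ε in 𝓝[>] (0 : ℝ), ∀ z ∈ J, z ∈ Ioo (p - ε) (q + ε) → z = p ∨ z = q := by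
      rw [Finset.eventually_all]
      intro z hz
      by_cases hzpq : z = p ∨ z = q
      · exact Eventually.of_forall fun _ _ => hzpq
      · rw [not_or] at hzpq
        rcases lt_or_gt_of_ne hzpq.1 with hzp | hzp
        · filter_upwards [Ioo_mem_nhdsGT (sub_pos.2 hzp)] with ε hε hI
          linarith [hε.2, hI.1]
        · have hqz : q < z := by
            by_contra hle
            exact hcons z hz ⟨hzp, lt_of_le_of_ne (not_lt.1 hle) hzpq.2⟩
          filter_upwards [Ioo_mem_nhdsGT (sub_pos.2 hqz)] with ε hε hI
          linarith [hε.2, hI.2]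
    obtain ⟨ε, h1, h2, h3, h4, h5⟩ :=
      ((eventually_mem_nhdsWithin (a := (0 : ℝ)) (s := Ioi 0)).and
        (e1.and (e2.and (e3.and e4)))).exists
    exact ⟨ε, h1, h2.le, h3.le, h4, h5⟩
  set s := p - ε with hs
  set t := q + ε with ht
  have hsp : s < p := by linarith
  have hqt : q < t := by linarith
  have hst : s < t := by linarith
  have hpqne : p ≠ q := hpq.ne
  have hJst : J.filter (· ∈ Ioo s t) = {p, q} := by
    ext z
    simp only [Finset.mem_filter, Finset.mem_insert, Finset.mem_singleton]
    constructor
    · exact fun hz => hεJ z hz.1 hz.2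
    · rintro (rfl | rfl)
      · exact ⟨hp, hsp, hpq.trans hqt⟩
      · exact ⟨hq, hsp.trans hpq, hqt⟩
  have hJsp : J.filter (· ∈ Ioc s p) = {p} := by
    ext z
    simp only [Finset.mem_filter, Finset.mem_singleton]
    constructor
    · rintro ⟨hz, hz1, hz2⟩
      exact (hεJ z hz ⟨hz1, hz2.trans_lt (hpq.trans hqt)⟩).resolve_right
        (hz2.trans_lt hpq).ne
    · rintro rfl
      exact ⟨hp, hsp, le_rfl⟩
  have hJpq : J.filter (· ∈ Ioc p q) = {q} := by
    ext z
    simp only [Finset.mem_filter, Finset.mem_singleton]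
    constructor
    · rintro ⟨hz, hz1, hz2⟩
      exact (hεJ z hz ⟨hsp.trans hz1, hz2.trans_lt hqt⟩).resolve_left hz1.ne'
    · rintro rfl
      exact ⟨hq, hpq, le_rfl⟩
  have hVp : cumul c σ κ p - cumul c σ κ s = σ.real {p} - κ.real {p} := by
    rw [cumul_sub_eq_sum hJ hsp.le, hJsp, Finset.sum_singleton]
  have hVq : cumul c σ κ q - cumul c σ κ p = σ.real {q} - κ.real {q} := by
    rw [cumul_sub_eq_sum hJ hpq.le, hJpq, Finset.sum_singleton]
  have hσI : σ.real (Ioo s t) = σ.real {p} + σ.real {q} := by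
    rw [real_eq_sum_of_compl_null (measure_null_of_add_null hJ).1, hJst, Finset.sum_pair hpqne]
  have hκI : κ.real (Ioo s t) = κ.real {p} + κ.real {q} := by
    rw [real_eq_sum_of_compl_null (measure_null_of_add_null hJ).2, hJst, Finset.sum_pair hpqne]
  have h0 : ∀ x, σ.real {x} = 0 ∨ κ.real {x} = 0 := by
    obtain ⟨A, -, h1, h2⟩ := h.mutuallySingular
    intro x
    by_cases hx : x ∈ A
    · exact Or.inl ((measureReal_eq_zero_iff).2
        (measure_mono_null (singleton_subset_iff.2 hx) h1))
    · exact Or.inr ((measureReal_eq_zero_iff).2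
        (measure_mono_null (singleton_subset_iff.2 hx) h2))
  have hsI := hVI s ⟨hεa, by linarith⟩
  have hpI := hVI p ⟨by linarith, by linarith⟩
  have hqI := hVI q ⟨by linarith, by linarith⟩
  have habs : ∀ {v : ℝ}, v ∈ Icc lo hi → ∀ x ∈ Ioo s t, |v - g x| ≤ M := by
    intro v hv x hx
    have hgx := hgI x ⟨by linarith [hx.1], by linarith [hx.2]⟩
    rw [abs_le]
    constructor <;> linarith [hv.1, hv.2, hgx.1, hgx.2]
  -- Each jump is charged by only one of `σ` and `κ`. Their masses on the interval are thus zero,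
  -- one jump, or two jumps of equal sign, all differences of values in `[lo, hi]`.
  obtain ⟨x₀, hx₀⟩ := h.exists_atom hK1 hK2 hK3 hlam hg hεa hst hεb hC hc₀
    (by
      rw [hσI]
      rcases h0 p with e1 | e1 <;> rcases h0 q with e2 | e2 <;>
        linarith [hsI.1, hsI.2, hpI.1, hpI.2, hqI.1, hqI.2])
    (by
      rw [hκI]
      rcases h0 p with e1 | e1 <;> rcases h0 q with e2 | e2 <;>
        linarith [hsI.1, hsI.2, hpI.1, hpI.2, hqI.1, hqI.2])
    (fun x hx => habs (hVI x ⟨by linarith [hx.1], by linarith [hx.2]⟩) x hx)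
    (fun x hx => habs hsI x hx)
    (fun x hx => by
      have : cumul c σ κ s + (σ.real (Ioo s t) - κ.real (Ioo s t)) = cumul c σ κ q := by
        rw [hσI, hκI]; linarith
      rw [this]
      exact habs hqI x hx)
    (hεl.trans_le (min_le_right _ _))
    ((lt_div_iff₀ hM0).1 (hεl.trans_le (min_le_left _ _)))
  have hx : ∀ x ∈ J, x ∈ Ioo s t → x = x₀ := by
    intro x hxJ hxI
    by_contra hne
    exact hJpos x hxJ (measure_mono_null (t := Ioo s t \ {x₀})
      (singleton_subset_iff.2 ⟨hxI, hne⟩) hx₀)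
  exact hpqne ((hx p hp ⟨hsp, hpq.trans hqt⟩).trans (hx q hq ⟨hsp.trans hpq, hqt⟩).symm)

end Jumps

end KWC

/-! ### The main theorem. -/

theorem theorem1p1 (K : ℝ → ℝ) (hK1 : KWC.CondK1 K) (hK2 : KWC.CondK2 K) (hK3 : KWC.CondK3 K)
    (a b : ℝ) (hab : a < b) (lam : ℝ) (hlam : 0 < lam)
    (g : ℝ → ℝ) (hg : ContinuousOn g (Set.Icc a b))
    (U : ℝ → ℝ) (hU : KWC.IsMinimizer K lam g a b U) :
    (∃ V : ℝ → ℝ, V =ᵐ[MeasureTheory.volume.restrict (Set.Ioo a b)] U ∧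
      ContinuousOn V (Set.Icc a b \ KWC.jumpSet a b U) ∧
      KWC.IsPiecewiseConst a b V ∧
      ∀ x ∈ Set.Icc a b, sInf (g '' Set.Icc a b) ≤ V x ∧ V x ≤ sSup (g '' Set.Icc a b)) ∧
    (KWC.jumpSet a b U).Finite ∧
    ∀ M C c : ℝ, 0 < M → sSup (g '' Set.Icc a b) - sInf (g '' Set.Icc a b) ≤ M →
      KWC.IsMergeConst K M C →
      0 < c → (∀ ρ ∈ Set.Icc 0 M, c * ρ ≤ K ρ) →
      (KWC.jumpSet a b U).ncard ≤ ⌊(b - a) * lam / min (c / M) (2 * C)⌋₊ + 1 := by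
  classical
  obtain ⟨v, σ, κ, _, _, hUV, hjump, h⟩ := hU.exists_isMinimalPair hK1 hK2 hK3 hab hlam hg
  obtain ⟨J, hJmem, hJab, hJ⟩ := h.exists_atoms_finset hK1 hK2 hK3 hlam hg
  have hjumpJ : KWC.jumpSet a b U = J := by
    rw [hjump]
    ext x
    exact (hJmem x).symm
  have himg := isCompact_Icc.image_of_continuousOn hg
  have hgI : ∀ x ∈ Set.Icc a b,
      g x ∈ Set.Icc (sInf (g '' Set.Icc a b)) (sSup (g '' Set.Icc a b)) := fun x hx =>
    ⟨csInf_le himg.bddBelow (Set.mem_image_of_mem g hx),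
      le_csSup himg.bddAbove (Set.mem_image_of_mem g hx)⟩
  have hVI : ∀ x ∈ Set.Icc a b, KWC.cumul v σ κ x ∈
      Set.Icc (sInf (g '' Set.Icc a b)) (sSup (g '' Set.Icc a b)) := fun x hx =>
    h.cumul_mem_Icc hK1 hK2 hK3 hab hlam hg hgI hx
  refine ⟨⟨KWC.cumul v σ κ, hUV, ?_, ?_, fun x hx => hVI x hx⟩, ?_, ?_⟩
  · intro x hx
    refine (KWC.continuousAt_cumul ?_).continuousWithinAt
    by_contra hne
    exact hx.2 (by rw [hjump]; exact hne)
  · refine KWC.isPiecewiseConst_of_finset hab J hJab fun x y _ hxy _ hz => ?_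
    rw [← sub_eq_zero, KWC.cumul_sub_eq_sum hJ hxy, Finset.filter_false_of_mem hz,
      Finset.sum_empty]
  · rw [hjumpJ]
    exact J.finite_toSet
  · intro M C c hM0 hM hC hc hcK
    rw [hjumpJ, Set.ncard_coe_finset]
    set A := min (c / M) (2 * C) with hA
    have hA0 : 0 < A := lt_min (div_pos hc hM0) (by have := hC.1; positivity)
    have hsep : ∀ p ∈ J, ∀ q ∈ J, p < q → p + A / lam ≤ q := by
      refine KWC.separated_of_consecutive fun p hp q hq hpq hcons => ?_
      have := h.min_le_of_consecutive hK1 hK2 hK3 hlam hg hJ (fun x hx => (hJmem x).1 hx) hJab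
        hgI hVI hM0 hM hC hcK hp hq hpq hcons
      have : A / lam ≤ q - p := by
        rw [div_le_iff₀ hlam]; linarith
      linarith
    -- The interval attached to the last jump may stick out beyond `b`, so the packing takes place
    -- in `[a, b + A / lam]`. This extra length is the `+ 1` in the bound.
    have hcard := KWC.card_mul_le_of_separated (a := a) (b := b + A / lam) J hsep
      (by have : 0 < A / lam := by positivity
          linarith)
      (fun y hy => ⟨(hJab y hy).1.le, by linarith [(hJab y hy).2]⟩)
    rcases Nat.eq_zero_or_eq_succ_pred J.card with h0 | h0
    · omega
    · rw [h0] at hcard ⊢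
      refine Nat.succ_le_succ (Nat.le_floor ?_)
      rw [le_div_iff₀ hA0]
      push_cast at hcard
      have : (J.card.pred : ℝ) * (A / lam) ≤ b - a := by linarith
      rw [mul_div_assoc', div_le_iff₀ hlam] at this
      exact this
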